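/- All Hilbert spaces are complex. Let $\mathscr M$ and $\mathscr N$ be von Neumann algebras acting on Hilbert spaces $\mathcal H$ and $\mathcal K$, and let $\Phi:\mathscr M\to\mathscr N$ be a unital normal $*$-homomorphism (normal: it preserves least upper bounds of increasing nets of self-adjoint elements). An unbounded operator on $\mathcal H$ is a linear map $T:\mathrm{dom}(T)\to\mathcal H$ on a linear subspace $\mathrm{dom}(T)\subseteq\mathcal H$, not necessarily dense. The product $ST$ has domain $\{x\in\mathrm{dom}(T):Tx\in\mathrm{dom}(S)\}$, and $S+T$ has domain $\mathrm{dom}(S)\cap\mathrm{dom}(T)$. For closed $S,T$, the strong-product $S\,\hat\cdot\,T:=\overline{ST}$ (respectively, the strong-sum $S\,\hat+\,T:=\overline{S+T}$) is defined whenever $ST$ (respectively, $S+T$) is pre-closed. The adjoint $T^*$ has as domain the set of $y\in\mathcal H$ for which $x\mapsto\langle Tx,y\rangle$ is continuous on $\mathrm{dom}(T)$, and $T^*y$ is the unique $z\in\overline{\mathrm{dom}(T)}$ with $\langle Tx,y\rangle=\langle x,z\rangle$ for all $x\in\mathrm{dom}(T)$. For bounded operators $A,B$ with $\mathrm{null}(B)\subseteq\mathrm{null}(A)$,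 let $A/B$ be the operator with domain $\mathrm{ran}(B)$ that sends $Bx$ to $Ax$. Put $$\mathscr M_{\mathrm{aff}}:=\{A/B: A,B\in\mathscr M,\ \mathrm{null}(B)\subseteq\mathrm{null}(A)\},$$ $$\mathscr M_{\mathrm{aff}}^{\mathrm{MvN}}:=\{T\text{ closed operator on }\mathcal H:\ U^*TU=T\text{ for every unitary }U\text{ in the commutant }\mathscr M'\},$$ and similarly for $\mathscr N$. The algebra $\mathscr M$ is viewed as a subset of $\mathscr M_{\mathrm{aff}}^{\mathrm{MvN}}$. The trivial affiliated operator $0_{\mathcal H}|_{\{0\}}\in\mathscr M_{\mathrm{aff}}^{\mathrm{MvN}}$ is the restriction of $0$ to the zero subspace. A map $\Psi:\mathscr M_{\mathrm{aff}}^{\mathrm{MvN}}\to\mathscr N_{\mathrm{aff}}^{\mathrm{MvN}}$ respects strong-products if, whenever $S\,\hat\cdot\,T$ is defined for $S,T\in\mathscr M_{\mathrm{aff}}^{\mathrm{MvN}}$, $\Psi(S)\,\hat\cdot\,\Psi(T)$ is also defined and $\Psi(S\,\hat\cdot\,T)=\Psi(S)\,\hat\cdot\,\Psi(T)$; respecting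 strong-sums is defined in the same way. It respects adjoints if $\Psi(T^*)=\Psi(T)^*$ for all $T\in\mathscr M_{\mathrm{aff}}^{\mathrm{MvN}}$. (The set $\mathscr M_{\mathrm{aff}}^{\mathrm{MvN}}$ is closed under adjoints and under strong-products and strong-sums that are defined.) **Theorem.** The map $\Phi_{\mathrm{aff}}:\mathscr M_{\mathrm{aff}}\to\mathscr N_{\mathrm{aff}}$, $\Phi_{\mathrm{aff}}(A/B):=\Phi(A)/\Phi(B)$, is well defined (in particular $\mathrm{null}(B)\subseteq\mathrm{null}(A)$ implies $\mathrm{null}(\Phi(B))\subseteq\mathrm{null}(\Phi(A))$), one has $\mathscr M_{\mathrm{aff}}^{\mathrm{MvN}}\subseteq\mathscr M_{\mathrm{aff}}$, and $\Phi_{\mathrm{aff}}$ maps $\mathscr M_{\mathrm{aff}}^{\mathrm{MvN}}$ into $\mathscr N_{\mathrm{aff}}^{\mathrm{MvN}}$. Its restriction to $\mathscr M_{\mathrm{aff}}^{\mathrm{MvN}}$ is the unique map $\mathscr M_{\mathrm{aff}}^{\mathrm{MvN}}\to\mathscr N_{\mathrm{aff}}^{\mathrm{MvN}}$ that extends $\Phi$,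 respects strong-products and adjoints, and sends $0_{\mathcal H}|_{\{0\}}$ to $0_{\mathcal K}|_{\{0\}}$. Moreover, this restriction respects strong-sums. -/

import Mathlib

noncomputable section

namespace Affiliation

universe u v

/-! ### Unbounded operators on a Hilbert space

An unbounded operator on `H` is a linear map defined on a linear subspace of `H`, that is, a term of
`H →ₗ.[ℂ] H`.  Its domain is not assumed to be dense.  The sum `S + T` of Mathlib has domain
`S.domain ⊓ T.domain`; closed operators, pre-closed operators and closures are
`LinearPMap.IsClosed`, `LinearPMap.IsClosable` and `LinearPMap.closure`. -/

section Operators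

variable {H : Type u} [NormedAddCommGroup H] [InnerProductSpace ℂ H]

/-- A bounded, everywhere-defined operator, seen as an unbounded operator. -/
def ofBounded (A : H →L[ℂ] H) : H →ₗ.[ℂ] H := (A : H →ₗ[ℂ] H).toPMap ⊤

/-- The restriction of the zero operator to the zero subspace. -/
def trivialOp (H : Type u) [NormedAddCommGroup H] [InnerProductSpace ℂ H] : H →ₗ.[ℂ] H :=
  (0 : H →ₗ[ℂ] H).toPMap ⊥

/-- The product `S T`, with domain `{x ∈ dom T : T x ∈ dom S}`. -/
def opMul (S T : H →ₗ.[ℂ] H) : H →ₗ.[ℂ] H where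
  domain := (S.domain.comap T.toFun).map T.domain.subtype
  toFun :=
    { toFun := fun x =>
        S ⟨T ⟨x, by obtain ⟨y, -, hy⟩ := x.2; exact hy ▸ y.2⟩, by
          obtain ⟨x, y, hy, rfl⟩ := x; exact hy⟩
      map_add' := by
        intro x y
        rw [← S.map_add]
        congr 1
        apply Subtype.ext
        exact T.map_add ⟨x, by obtain ⟨z, -, hz⟩ := x.2; exact hz ▸ z.2⟩
          ⟨y, by obtain ⟨z, -, hz⟩ := y.2; exact hz ▸ z.2⟩
      map_smul' := by
        intro c x
        rw [RingHom.id_apply, ← S.map_smul]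
        congr 1
        apply Subtype.ext
        exact T.map_smul c ⟨x, by obtain ⟨z, -, hz⟩ := x.2; exact hz ▸ z.2⟩ }

/-- The graph of the adjoint: all `(y, z)` such that `z` lies in the closure of `dom T` and
`⟪z, x⟫ = ⟪y, T x⟫` for every `x ∈ dom T`. -/
def adjGraph (T : H →ₗ.[ℂ] H) : Submodule ℂ (H × H) where
  carrier := {p | p.2 ∈ T.domain.topologicalClosure ∧
    ∀ x : T.domain, inner ℂ p.2 (x : H) = inner ℂ p.1 (T x)}
  zero_mem' := ⟨Submodule.zero_mem _, fun x => by simp⟩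
  add_mem' := fun {p q} hp hq =>
    ⟨Submodule.add_mem _ hp.1 hq.1, fun x => by
      simp only [Prod.fst_add, Prod.snd_add, inner_add_left, hp.2 x, hq.2 x]⟩
  smul_mem' := fun c p hp =>
    ⟨Submodule.smul_mem _ c hp.1, fun x => by
      simp only [Prod.smul_fst, Prod.smul_snd, inner_smul_left, hp.2 x]⟩

/-- The adjoint of a (not necessarily densely-defined) operator `T` on `H`: its domain consists of
the `y` for which `x ↦ ⟪y, T x⟫` is continuous on `dom T`, and it maps such a `y` to the unique `z`
in the closure of `dom T` with `⟪z, x⟫ = ⟪y, T x⟫` for all `x ∈ dom T`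
(see `adjGraph_functional` and `mem_opAdjoint_domain_iff`). -/
def opAdjoint (T : H →ₗ.[ℂ] H) : H →ₗ.[ℂ] H := (adjGraph T).toLinearPMap

/-- The quotient `A / B` of bounded operators with `null B ⊆ null A`: the operator with domain
`ran B` that maps `B x` to `A x`; its graph is `{(B x, A x) : x ∈ H}`
(see `quotient_domain` and `quotient_apply`). -/
def quotient (A B : H →L[ℂ] H) : H →ₗ.[ℂ] H :=
  (LinearMap.range ((B : H →ₗ[ℂ] H).prod (A : H →ₗ[ℂ] H))).toLinearPMap

/-! Basic facts about these operations. -/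

theorem mem_graph_ofBounded (A : H →L[ℂ] H) (x y : H) :
    (x, y) ∈ (ofBounded A).graph ↔ A x = y := by
  rw [LinearPMap.mem_graph_iff]
  constructor
  · rintro ⟨z, hz, hy⟩
    have hz' : (z : H) = x := hz
    have hy' : A (z : H) = y := hy
    rw [← hz', hy']
  · intro h
    exact ⟨⟨x, trivial⟩, rfl, h⟩

theorem mem_graph_trivialOp (x y : H) : (x, y) ∈ (trivialOp H).graph ↔ x = 0 ∧ y = 0 := by
  rw [LinearPMap.mem_graph_iff]
  constructor
  · rintro ⟨z, hz, hy⟩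
    have hz' : (z : H) = x := hz
    have hy' : (0 : H) = y := hy
    exact ⟨hz' ▸ (Submodule.mem_bot ℂ).1 z.2, hy'.symm⟩
  · rintro ⟨rfl, rfl⟩
    exact ⟨⟨0, Submodule.zero_mem _⟩, rfl, rfl⟩

theorem mem_graph_opMul (S T : H →ₗ.[ℂ] H) (x z : H) :
    (x, z) ∈ (opMul S T).graph ↔ ∃ y, (x, y) ∈ T.graph ∧ (y, z) ∈ S.graph := by
  rw [LinearPMap.mem_graph_iff]
  constructor
  · rintro ⟨⟨w, w', hw', rfl⟩, hw, hz⟩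
    have hw0 : (w' : H) = x := hw
    subst hw0
    refine ⟨T w', T.mem_graph w', ?_⟩
    have hz' : S ⟨T w', hw'⟩ = z := hz
    rw [← hz']
    exact S.mem_graph ⟨T w', hw'⟩
  · rintro ⟨y, h1, h2⟩
    obtain ⟨w, hw, hy⟩ := (LinearPMap.mem_graph_iff T).1 h1
    obtain ⟨t, ht, hz⟩ := (LinearPMap.mem_graph_iff S).1 h2
    simp only at hw hy ht hz
    subst hw hz
    have hmem : T w ∈ S.domain := by rw [hy, ← ht]; exact t.2
    refine ⟨⟨w, w, hmem, rfl⟩, rfl, ?_⟩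
    change S ⟨T w, hmem⟩ = S t
    congr 1
    exact Subtype.ext (hy.trans ht.symm)

theorem mem_graph_add (S T : H →ₗ.[ℂ] H) (x z : H) :
    (x, z) ∈ (S + T).graph ↔ ∃ a b, (x, a) ∈ S.graph ∧ (x, b) ∈ T.graph ∧ a + b = z := by
  rw [LinearPMap.mem_graph_iff]
  constructor
  · rintro ⟨w, hw, hz⟩
    have hw' : (w : H) = x := hw
    subst hw'
    exact ⟨S ⟨w, w.2.1⟩, T ⟨w, w.2.2⟩, S.mem_graph ⟨w, w.2.1⟩, T.mem_graph ⟨w, w.2.2⟩, hz⟩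
  · rintro ⟨a, b, ha, hb, rfl⟩
    obtain ⟨s, hs, rfl⟩ := (LinearPMap.mem_graph_iff S).1 ha
    obtain ⟨t, ht, rfl⟩ := (LinearPMap.mem_graph_iff T).1 hb
    simp only at hs ht
    subst hs
    refine ⟨⟨s, s.2, ht ▸ t.2⟩, rfl, ?_⟩
    change S ⟨s, s.2⟩ + T ⟨s, ht ▸ t.2⟩ = S s + T t
    congr 2
    exact Subtype.ext ht.symm

theorem graph_quotient {A B : H →L[ℂ] H}
    (h : LinearMap.ker (B : H →ₗ[ℂ] H) ≤ LinearMap.ker (A : H →ₗ[ℂ] H)) :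
    (quotient A B).graph = LinearMap.range ((B : H →ₗ[ℂ] H).prod (A : H →ₗ[ℂ] H)) := by
  apply Submodule.toLinearPMap_graph_eq
  rintro ⟨p, q⟩ ⟨x, hx⟩ hp
  have h1 : B x = p := congrArg Prod.fst hx
  have h2 : A x = q := congrArg Prod.snd hx
  have hp' : p = 0 := hp
  have h3 : x ∈ LinearMap.ker (A : H →ₗ[ℂ] H) := h (by
    rw [LinearMap.mem_ker]; exact h1.trans hp')
  exact h2.symm.trans h3

theorem quotient_domain (A B : H →L[ℂ] H) :
    (quotient A B).domain = LinearMap.range (B : H →ₗ[ℂ] H) := by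
  ext y
  change y ∈ (LinearMap.range _).map _ ↔ _
  constructor
  · rintro ⟨_, ⟨x, rfl⟩, rfl⟩
    exact ⟨x, rfl⟩
  · rintro ⟨x, rfl⟩
    exact ⟨_, ⟨x, rfl⟩, rfl⟩

theorem quotient_apply {A B : H →L[ℂ] H}
    (h : LinearMap.ker (B : H →ₗ[ℂ] H) ≤ LinearMap.ker (A : H →ₗ[ℂ] H)) (x : H) :
    quotient A B ⟨B x, by rw [quotient_domain]; exact ⟨x, rfl⟩⟩ = A x := by
  have h1 : (B x, A x) ∈ (quotient A B).graph := by
    rw [graph_quotient h]; exact ⟨x, rfl⟩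
  exact ((LinearPMap.image_iff _).2 h1).symm

theorem adjGraph_functional (T : H →ₗ.[ℂ] H) {y z z' : H}
    (h : (y, z) ∈ adjGraph T) (h' : (y, z') ∈ adjGraph T) : z = z' := by
  have hmem : z - z' ∈ T.domain.topologicalClosure := Submodule.sub_mem _ h.1 h'.1
  have horth : z - z' ∈ (T.domain)ᗮ := by
    rw [Submodule.mem_orthogonal']
    intro x hx
    have e := h.2 ⟨x, hx⟩
    have e' := h'.2 ⟨x, hx⟩
    simp only at e e'
    rw [inner_sub_left, e, e', sub_self]
  rw [← Submodule.orthogonal_closure] at horth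
  have := Submodule.inner_right_of_mem_orthogonal hmem horth
  exact sub_eq_zero.1 (inner_self_eq_zero.1 this)

theorem mem_graph_opAdjoint (T : H →ₗ.[ℂ] H) (p : H × H) :
    p ∈ (opAdjoint T).graph ↔ p.2 ∈ T.domain.topologicalClosure ∧
      ∀ x y, (x, y) ∈ T.graph → inner ℂ p.2 x = inner ℂ p.1 y := by
  have e : (opAdjoint T).graph = adjGraph T := by
    apply Submodule.toLinearPMap_graph_eq
    rintro ⟨p, q⟩ h hp
    have hp' : p = 0 := hp
    subst hp'
    exact adjGraph_functional T h (Submodule.zero_mem _)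
  rw [e]
  constructor
  · rintro ⟨h1, h2⟩
    refine ⟨h1, fun x y hxy => ?_⟩
    obtain ⟨w, rfl, rfl⟩ := (LinearPMap.mem_graph_iff T).1 hxy
    exact h2 w
  · rintro ⟨h1, h2⟩
    exact ⟨h1, fun x => h2 _ _ (T.mem_graph x)⟩

theorem mem_opAdjoint_domain_iff [CompleteSpace H] (T : H →ₗ.[ℂ] H) (y : H) :
    y ∈ (opAdjoint T).domain ↔ Continuous fun x : T.domain => inner ℂ y (T x) := by
  rw [LinearPMap.mem_domain_iff]
  constructor
  · rintro ⟨z, hz⟩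
    have h2 := ((mem_graph_opAdjoint T _).1 hz).2
    have : (fun x : T.domain => inner ℂ y (T x)) = fun x : T.domain => inner ℂ z (x : H) :=
      funext fun x => (h2 _ _ (T.mem_graph x)).symm
    rw [this]
    fun_prop
  · intro hc
    let f : StrongDual ℂ T.domain := ⟨(innerₛₗ ℂ y).comp T.toFun, hc⟩
    obtain ⟨g, hg, -⟩ := exists_extension_norm_eq T.domain f
    let w : H := (InnerProductSpace.toDual ℂ H).symm g
    have hw : ∀ x : T.domain, inner ℂ w (x : H) = inner ℂ y (T x) := fun x => by
      rw [InnerProductSpace.toDual_symm_apply, hg x]; rfl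
    have : CompleteSpace T.domain.topologicalClosure :=
      T.domain.isClosed_topologicalClosure.completeSpace_coe
    refine ⟨T.domain.topologicalClosure.starProjection w, (mem_graph_opAdjoint T _).2
      ⟨Submodule.starProjection_apply_mem _ _, fun x v hxv => ?_⟩⟩
    obtain ⟨x, rfl, rfl⟩ := (LinearPMap.mem_graph_iff T).1 hxv
    change inner ℂ (T.domain.topologicalClosure.starProjection w) (x : H) = inner ℂ y (T x)
    rw [← hw x, Submodule.inner_starProjection_left_eq_right,
      Submodule.starProjection_eq_self_iff.2 (T.domain.le_topologicalClosure x.2)]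

end Operators

/-! ### Affiliated operators -/

section Affiliated

variable {H : Type u} [NormedAddCommGroup H] [InnerProductSpace ℂ H] [CompleteSpace H]

/-- The set of operators affiliated with `M`: the quotients `A / B` with `A, B ∈ M` and
`null B ⊆ null A`. -/
def aff (M : VonNeumannAlgebra H) : Set (H →ₗ.[ℂ] H) :=
  {T | ∃ A B : M.toStarSubalgebra,
    LinearMap.ker ((B : H →L[ℂ] H) : H →ₗ[ℂ] H) ≤ LinearMap.ker ((A : H →L[ℂ] H) : H →ₗ[ℂ] H) ∧
      T = quotient (A : H →L[ℂ] H) (B : H →L[ℂ] H)}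

/-- The set of closed operators affiliated with `M` in the sense of Murray and von Neumann: the
closed operators `T` with `U* T U = T` for every unitary `U` in the commutant of `M`. -/
def mvnAff (M : VonNeumannAlgebra H) : Set (H →ₗ.[ℂ] H) :=
  {T | T.IsClosed ∧ ∀ U ∈ M.commutant, U ∈ unitary (H →L[ℂ] H) →
    opMul (opMul (ofBounded (star U)) T) (ofBounded U) = T}

theorem unitary_left {U : H →L[ℂ] H} (hU : U ∈ unitary (H →L[ℂ] H)) (x : H) :
    (star U) (U x) = x := by
  have := congrArg (fun f : H →L[ℂ] H => f x) (Unitary.star_mul_self_of_mem hU)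
  exact this

theorem unitary_right {U : H →L[ℂ] H} (hU : U ∈ unitary (H →L[ℂ] H)) (x : H) :
    U ((star U) x) = x := by
  have := congrArg (fun f : H →L[ℂ] H => f x) (Unitary.mul_star_self_of_mem hU)
  exact this

theorem unitary_inner {U : H →L[ℂ] H} (hU : U ∈ unitary (H →L[ℂ] H)) (x y : H) :
    inner ℂ (U x) (U y) = inner ℂ x y := by
  rw [← ContinuousLinearMap.adjoint_inner_right, ← ContinuousLinearMap.star_eq_adjoint,
    unitary_left hU]

theorem conj_eq_iff {U : H →L[ℂ] H} (hU : U ∈ unitary (H →L[ℂ] H)) (T : H →ₗ.[ℂ] H) :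
    opMul (opMul (ofBounded (star U)) T) (ofBounded U) = T ↔
      ∀ x y, (U x, U y) ∈ T.graph ↔ (x, y) ∈ T.graph := by
  have key : ∀ x y, (x, y) ∈ (opMul (opMul (ofBounded (star U)) T) (ofBounded U)).graph ↔
      (U x, U y) ∈ T.graph := by
    intro x y
    simp only [mem_graph_opMul, mem_graph_ofBounded]
    constructor
    · rintro ⟨a, rfl, b, hb, rfl⟩
      rwa [unitary_right hU]
    · intro h
      exact ⟨U x, rfl, U y, h, unitary_left hU y⟩
  constructor
  · intro h x y
    rw [← key, h]
  · intro h
    apply LinearPMap.eq_of_eq_graph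
    ext ⟨x, y⟩
    rw [key, h]

theorem mem_mvnAff_iff (M : VonNeumannAlgebra H) (T : H →ₗ.[ℂ] H) :
    T ∈ mvnAff M ↔ T.IsClosed ∧ ∀ U ∈ M.commutant, U ∈ unitary (H →L[ℂ] H) →
      ∀ x y, (U x, U y) ∈ T.graph ↔ (x, y) ∈ T.graph := by
  refine and_congr_right fun _ => forall_congr' fun U => forall_congr' fun _ =>
    forall_congr' fun hU => conj_eq_iff hU T

/-- Invariance of a graph under a unitary passes to the closure of the graph. -/
theorem closure_invariant {U : H →L[ℂ] H} (hU : U ∈ unitary (H →L[ℂ] H)) {G : Set (H × H)}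
    (hG : ∀ x y, (U x, U y) ∈ G ↔ (x, y) ∈ G) (x y : H) :
    (U x, U y) ∈ _root_.closure G ↔ (x, y) ∈ _root_.closure G := by
  constructor
  · intro h
    have hc : Continuous fun p : H × H => ((star U) p.1, (star U) p.2) := by fun_prop
    have := map_mem_closure hc h (t := G) (fun p hp => by
      rw [← hG]
      simpa only [unitary_right hU] using hp)
    simpa only [unitary_left hU] using this
  · intro h
    have hc : Continuous fun p : H × H => (U p.1, U p.2) := by fun_prop
    have := map_mem_closure hc h (t := G) (fun p hp => (hG p.1 p.2).2 hp)
    exact this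

theorem closure_mem_mvnAff (M : VonNeumannAlgebra H) {T : H →ₗ.[ℂ] H} (hT : T.IsClosable)
    (h : ∀ U ∈ M.commutant, U ∈ unitary (H →L[ℂ] H) →
      ∀ x y, (U x, U y) ∈ T.graph ↔ (x, y) ∈ T.graph) : T.closure ∈ mvnAff M := by
  rw [mem_mvnAff_iff]
  refine ⟨hT.closure_isClosed, fun U hUM hU x y => ?_⟩
  rw [← hT.graph_closure_eq_closure_graph]
  exact closure_invariant hU (G := (T.graph : Set (H × H))) (h U hUM hU) x y

theorem ofBounded_mem_mvnAff (M : VonNeumannAlgebra H) (A : M.toStarSubalgebra) :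
    ofBounded (A : H →L[ℂ] H) ∈ mvnAff M := by
  rw [mem_mvnAff_iff]
  constructor
  · have e : (((ofBounded (A : H →L[ℂ] H)).graph : Submodule ℂ (H × H)) : Set (H × H)) =
        {p | (A : H →L[ℂ] H) p.1 = p.2} := by
      ext ⟨x, y⟩; exact mem_graph_ofBounded _ x y
    change _root_.IsClosed _
    rw [e]
    exact isClosed_eq (by fun_prop) (by fun_prop)
  · intro U hUM hU x y
    rw [mem_graph_ofBounded, mem_graph_ofBounded]
    have hc : (A : H →L[ℂ] H) (U x) = U ((A : H →L[ℂ] H) x) :=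
      congrArg (fun f : H →L[ℂ] H => f x) (VonNeumannAlgebra.mem_commutant_iff.1 hUM A A.2)
    rw [hc]
    constructor
    · intro h
      have := congrArg (fun v : H => (star U) v) h
      rwa [unitary_left hU, unitary_left hU] at this
    · rintro rfl; rfl

theorem trivialOp_mem_mvnAff (M : VonNeumannAlgebra H) : trivialOp H ∈ mvnAff M := by
  rw [mem_mvnAff_iff]
  constructor
  · have e : (((trivialOp H).graph : Submodule ℂ (H × H)) : Set (H × H)) = {(0, 0)} := by
      ext ⟨x, y⟩
      rw [SetLike.mem_coe, mem_graph_trivialOp]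
      simp
    change _root_.IsClosed _
    rw [e]
    exact isClosed_singleton
  · intro U _ hU x y
    have inj : ∀ z, U z = 0 ↔ z = 0 := fun z => by
      constructor
      · intro h
        rw [← unitary_left hU z, h, map_zero]
      · rintro rfl; exact map_zero U
    rw [mem_graph_trivialOp, mem_graph_trivialOp, inj, inj]

theorem opAdjoint_mem_mvnAff (M : VonNeumannAlgebra H) {T : H →ₗ.[ℂ] H} (hT : T ∈ mvnAff M) :
    opAdjoint T ∈ mvnAff M := by
  rw [mem_mvnAff_iff] at hT ⊢
  constructor
  · have e : (((opAdjoint T).graph : Submodule ℂ (H × H)) : Set (H × H)) =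
        {p | p.2 ∈ T.domain.topologicalClosure} ∩
          ⋂ q ∈ T.graph, {p | inner ℂ p.2 q.1 = inner ℂ p.1 q.2} := by
      ext p
      rw [SetLike.mem_coe, mem_graph_opAdjoint]
      simp only [Set.mem_inter_iff, Set.mem_ofPred_eq, Set.mem_iInter, Prod.forall]
    change _root_.IsClosed _
    rw [e]
    refine (T.domain.isClosed_topologicalClosure.preimage continuous_snd).inter
      (isClosed_biInter fun q _ => isClosed_eq (by fun_prop) (by fun_prop))
  · intro U hUM hU y z
    have hinv := hT.2 U hUM hU
    have hdom : ∀ x, U x ∈ T.domain ↔ x ∈ T.domain := by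
      intro x
      rw [LinearPMap.mem_domain_iff, LinearPMap.mem_domain_iff]
      constructor
      · rintro ⟨w, hw⟩
        refine ⟨(star U) w, (hinv _ _).1 ?_⟩
        rwa [unitary_right hU]
      · rintro ⟨w, hw⟩
        exact ⟨U w, (hinv _ _).2 hw⟩
    have hcl : U z ∈ T.domain.topologicalClosure ↔ z ∈ T.domain.topologicalClosure := by
      constructor
      · intro h
        have := map_mem_closure (star U).continuous h (t := (T.domain : Set H)) (fun p hp => by
          rw [SetLike.mem_coe, ← hdom, unitary_right hU]; exact hp)
        rwa [unitary_left hU] at this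
      · intro h
        exact map_mem_closure U.continuous h (t := (T.domain : Set H))
          (fun p hp => (hdom p).2 hp)
    rw [mem_graph_opAdjoint, mem_graph_opAdjoint]
    refine and_congr hcl ?_
    constructor
    · intro h a b hab
      have := h _ _ ((hinv a b).2 hab)
      simpa only [unitary_inner hU] using this
    · intro h a b hab
      have hab' : ((star U) a, (star U) b) ∈ T.graph := by
        rw [← hinv, unitary_right hU, unitary_right hU]; exact hab
      have := h _ _ hab'
      simp only at this ⊢
      rwa [← unitary_inner hU, ← unitary_inner hU y, unitary_right hU, unitary_right hU] at this

theorem closure_opMul_mem_mvnAff (M : VonNeumannAlgebra H) {S T : H →ₗ.[ℂ] H}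
    (hS : S ∈ mvnAff M) (hT : T ∈ mvnAff M) (h : (opMul S T).IsClosable) :
    (opMul S T).closure ∈ mvnAff M := by
  rw [mem_mvnAff_iff] at hS hT
  refine closure_mem_mvnAff M h fun U hUM hU x z => ?_
  rw [mem_graph_opMul, mem_graph_opMul]
  constructor
  · rintro ⟨y, h1, h2⟩
    refine ⟨(star U) y, (hT.2 U hUM hU _ _).1 ?_, (hS.2 U hUM hU _ _).1 ?_⟩ <;>
      rwa [unitary_right hU]
  · rintro ⟨y, h1, h2⟩
    exact ⟨U y, (hT.2 U hUM hU _ _).2 h1, (hS.2 U hUM hU _ _).2 h2⟩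

theorem closure_add_mem_mvnAff (M : VonNeumannAlgebra H) {S T : H →ₗ.[ℂ] H}
    (hS : S ∈ mvnAff M) (hT : T ∈ mvnAff M) (h : (S + T).IsClosable) :
    (S + T).closure ∈ mvnAff M := by
  rw [mem_mvnAff_iff] at hS hT
  refine closure_mem_mvnAff M h fun U hUM hU x z => ?_
  rw [mem_graph_add, mem_graph_add]
  constructor
  · rintro ⟨a, b, h1, h2, h3⟩
    refine ⟨(star U) a, (star U) b, (hS.2 U hUM hU _ _).1 ?_, (hT.2 U hUM hU _ _).1 ?_, ?_⟩
    · rwa [unitary_right hU]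
    · rwa [unitary_right hU]
    · rw [← map_add, h3, unitary_left hU]
  · rintro ⟨a, b, h1, h2, rfl⟩
    exact ⟨U a, U b, (hS.2 U hUM hU _ _).2 h1, (hT.2 U hUM hU _ _).2 h2, (map_add U a b).symm⟩

variable (M : VonNeumannAlgebra H)

/-- The inclusion of `M` in its set of MvN-affiliated operators. -/
def incl (A : M.toStarSubalgebra) : mvnAff M :=
  ⟨ofBounded (A : H →L[ℂ] H), ofBounded_mem_mvnAff M A⟩

/-- The trivial affiliated operator. -/
def triv : mvnAff M := ⟨trivialOp H, trivialOp_mem_mvnAff M⟩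

variable {M}

/-- The adjoint, as an operation on MvN-affiliated operators. -/
def adj (T : mvnAff M) : mvnAff M := ⟨opAdjoint T, opAdjoint_mem_mvnAff M T.2⟩

/-- The strong-product of `S` and `T`: the closure of `S T`, defined when `S T` is pre-closed. -/
def strongProd (S T : mvnAff M) (h : (opMul (S : H →ₗ.[ℂ] H) T).IsClosable) : mvnAff M :=
  ⟨(opMul (S : H →ₗ.[ℂ] H) T).closure, closure_opMul_mem_mvnAff M S.2 T.2 h⟩

/-- The strong-sum of `S` and `T`: the closure of `S + T`, defined when `S + T` is pre-closed. -/
def strongSum (S T : mvnAff M) (h : ((S : H →ₗ.[ℂ] H) + T).IsClosable) : mvnAff M :=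
  ⟨((S : H →ₗ.[ℂ] H) + T).closure, closure_add_mem_mvnAff M S.2 T.2 h⟩

end Affiliated

/-! ### Extensions of a unital normal homomorphism -/

section Morphisms

variable {H : Type u} [NormedAddCommGroup H] [InnerProductSpace ℂ H] [CompleteSpace H]
  {K : Type v} [NormedAddCommGroup K] [InnerProductSpace ℂ K] [CompleteSpace K]
  {M : VonNeumannAlgebra H} {N : VonNeumannAlgebra K}

/-- A (unital `*`-) homomorphism is normal if it preserves least upper bounds of increasing nets
of self-adjoint elements. -/
def IsNormalHom (Φ : M.toStarSubalgebra →⋆ₐ[ℂ] N.toStarSubalgebra) : Prop :=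
  ∀ (D : Set M.toStarSubalgebra) (A : M.toStarSubalgebra), D.Nonempty → DirectedOn (· ≤ ·) D →
    (∀ X ∈ D, IsSelfAdjoint X) → IsLUB D A → IsLUB (Φ '' D) (Φ A)

/-- The map `Φ_aff` on operators affiliated with `M`, which sends `A / B` to `Φ A / Φ B`
for a representation `A / B` of the given operator. -/
def phiAff (Φ : M.toStarSubalgebra →⋆ₐ[ℂ] N.toStarSubalgebra) (T : aff M) : K →ₗ.[ℂ] K :=
  quotient (Φ T.2.choose : K →L[ℂ] K) (Φ T.2.choose_spec.choose : K →L[ℂ] K)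

/-- `Ψ` extends `Φ`. -/
def Extends (Φ : M.toStarSubalgebra →⋆ₐ[ℂ] N.toStarSubalgebra) (Ψ : mvnAff M → mvnAff N) : Prop :=
  ∀ A : M.toStarSubalgebra, Ψ (incl M A) = incl N (Φ A)

/-- `Ψ` respects strong-product: whenever the strong-product of `S` and `T` is defined, so is that
of `Ψ S` and `Ψ T`, and it is the image of the former. -/
def RespectsStrongProd (Ψ : mvnAff M → mvnAff N) : Prop :=
  ∀ (S T : mvnAff M) (h : (opMul (S : H →ₗ.[ℂ] H) T).IsClosable),
    ∃ h' : (opMul (Ψ S : K →ₗ.[ℂ] K) (Ψ T)).IsClosable,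
      Ψ (strongProd S T h) = strongProd (Ψ S) (Ψ T) h'

/-- `Ψ` respects strong-sum: whenever the strong-sum of `S` and `T` is defined, so is that
of `Ψ S` and `Ψ T`, and it is the image of the former. -/
def RespectsStrongSum (Ψ : mvnAff M → mvnAff N) : Prop :=
  ∀ (S T : mvnAff M) (h : ((S : H →ₗ.[ℂ] H) + T).IsClosable),
    ∃ h' : ((Ψ S : K →ₗ.[ℂ] K) + Ψ T).IsClosable,
      Ψ (strongSum S T h) = strongSum (Ψ S) (Ψ T) h'

/-- `Ψ` extends `Φ`, respects strong-product and adjoint, and maps the trivial affiliated operator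
to the trivial affiliated operator. -/
structure IsMvNExtension (Φ : M.toStarSubalgebra →⋆ₐ[ℂ] N.toStarSubalgebra)
    (Ψ : mvnAff M → mvnAff N) : Prop where
  ext : Extends Φ Ψ
  strongProd : RespectsStrongProd Ψ
  adjoint : ∀ T : mvnAff M, Ψ (adj T) = adj (Ψ T)
  trivial : Ψ (triv M) = triv N

end Morphisms

end Affiliation

end

noncomputable section

namespace Affiliation

universe u v

set_option linter.unusedSectionVars false

/-! The graph of `A / B` is the range of the column `(B, A)`, so affiliated operators can be handled
through two-row matrices over `M`, acting between finite Hilbert sums of copies of `H`. Applying `Φ`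
entrywise preserves sums, products and adjoints of matrices. What must be shown is that it also
preserves the relations between ranges and kernels that describe unbounded operators. Two facts do
this.

Ranges: by Douglas' lemma `ran C ⊆ ran D` means `C = D X`. The solution with values in `(ker D)ᗮ` is
unique, so it commutes with the diagonal action of the commutant and has entries in `M`
(`exists_eq_mul_of_ranM_le`). A range inclusion is thus an algebraic identity and passes through
`Φ`.

Kernels: `1 - ε (Xᴴ X + ε)⁻¹` increases, as `ε` decreases to `0`, to the complement of the
projection onto `ker X`. The equations of resolvents pass through `Φ`. Normality, used on diagonal
entries only, then gives `map_kerProj`. Hence inclusions of kernels are preserved.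

The graph of a closure is the range of `1 - [ker Cᴴ]`, where `[·]` denotes a kernel projection.
Closability is an inclusion of kernels, and the graphs of `S T`, `S + T` and `T*` are ranges of
matrices built from the entries and kernel projections. So `Φ_aff` commutes with all these
operations.

For a Murray-von Neumann affiliated `T`, the projection onto the graph is a matrix over `M`. Its
first column has range dense in the graph, and the partial isometry in the polar decomposition of
that column has range equal to the graph. This writes `T` as a quotient (`exists_col_represents`).

For uniqueness, `a / b = a · b⁻¹`, where `b⁻¹` inverts `b` on the complement of its kernel. The
strong-products of `b` and `b⁻¹` in both orders are a projection in `M` and the identity restricted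
to a closed subspace. The trivial operator and adjoints control the image of this restriction, and
this determines `Ψ (b⁻¹)`. -/

/-! ### Matrices of bounded operators -/

section Matrices

variable {H : Type u} [NormedAddCommGroup H] [InnerProductSpace ℂ H]
variable {ι κ μ : Type} [Fintype ι] [Fintype κ] [Fintype μ]

/-- The Hilbert sum of copies of `H` indexed by `ι`. -/
abbrev Amp (H : Type u) (ι : Type) : Type u := PiLp 2 (fun _ : ι => H)

/-- The operator between Hilbert sums given by a matrix of bounded operators. -/
def op (A : Matrix κ ι (H →L[ℂ] H)) : Amp H ι →L[ℂ] Amp H κ :=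
  ((PiLp.continuousLinearEquiv 2 ℂ (fun _ : κ => H)).symm : (κ → H) →L[ℂ] Amp H κ) ∘L
    ContinuousLinearMap.pi fun k => ∑ i, A k i ∘L PiLp.proj 2 (fun _ : ι => H) i

theorem op_apply (A : Matrix κ ι (H →L[ℂ] H)) (x : Amp H ι) (k : κ) :
    op A x k = ∑ i, A k i (x i) := by
  simp [op]

theorem op_mul (A : Matrix μ κ (H →L[ℂ] H)) (B : Matrix κ ι (H →L[ℂ] H)) :
    op (A * B) = op A ∘L op B := by
  ext x m
  simp only [op_apply, ContinuousLinearMap.comp_apply, Matrix.mul_apply, map_sum]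
  rw [Finset.sum_comm]
  simp

theorem op_add (A B : Matrix κ ι (H →L[ℂ] H)) : op (A + B) = op A + op B := by
  ext x k
  simp [op_apply, Finset.sum_add_distrib]

theorem op_sub (A B : Matrix κ ι (H →L[ℂ] H)) : op (A - B) = op A - op B := by
  ext x k
  simp [op_apply, Finset.sum_sub_distrib]

theorem op_smul (c : ℂ) (A : Matrix κ ι (H →L[ℂ] H)) : op (c • A) = c • op A := by
  ext x k
  simp [op_apply, Finset.smul_sum]

theorem op_zero : op (0 : Matrix κ ι (H →L[ℂ] H)) = 0 := by
  ext x k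
  simp [op_apply]

theorem op_one [DecidableEq ι] : op (1 : Matrix ι ι (H →L[ℂ] H)) = ContinuousLinearMap.id ℂ _ := by
  ext x k
  simp only [op_apply, Matrix.one_apply, ContinuousLinearMap.id_apply]
  rw [Finset.sum_eq_single k]
  · simp
  · intro i _ hi
    simp [hi.symm]
  · simp

theorem op_single [DecidableEq ι] (A : Matrix κ ι (H →L[ℂ] H)) (k : κ) (i : ι) (h : H) :
    op A (PiLp.single 2 i h) k = A k i h := by
  rw [op_apply, Finset.sum_eq_single i]
  · simp
  · intro j _ hj
    simp [hj]
  · simp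

theorem op_injective : Function.Injective (op : Matrix κ ι (H →L[ℂ] H) → _) := by
  classical
  intro A B h
  ext k i x
  rw [← op_single, h, op_single]

variable [CompleteSpace H]

theorem op_inner (A : Matrix κ ι (H →L[ℂ] H)) (x : Amp H ι) (y : Amp H κ) :
    inner ℂ (op A.conjTranspose y) x = inner ℂ y (op A x) := by
  simp only [PiLp.inner_apply, op_apply, sum_inner, inner_sum, Matrix.conjTranspose_apply]
  rw [Finset.sum_comm]
  refine Finset.sum_congr rfl fun k _ => Finset.sum_congr rfl fun i _ => ?_
  rw [ContinuousLinearMap.star_eq_adjoint, ContinuousLinearMap.adjoint_inner_left]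

theorem op_conjTranspose (A : Matrix κ ι (H →L[ℂ] H)) :
    op A.conjTranspose = ContinuousLinearMap.adjoint (op A) := by
  rw [ContinuousLinearMap.eq_adjoint_iff]
  exact fun y x => op_inner A x y

end Matrices

/-! ### Matrices over a von Neumann algebra and the diagonal commutant -/

section VN

variable {H : Type u} [NormedAddCommGroup H] [InnerProductSpace ℂ H] [CompleteSpace H]
variable {M : VonNeumannAlgebra H}
variable {ι κ μ : Type} [Fintype ι] [Fintype κ] [Fintype μ]

/-- The operator given by a matrix over a von Neumann algebra. -/
def opM (A : Matrix κ ι M.toStarSubalgebra) : Amp H ι →L[ℂ] Amp H κ :=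
  op (A.map fun a => (a : H →L[ℂ] H))

theorem opM_apply (A : Matrix κ ι M.toStarSubalgebra) (x : Amp H ι) (k : κ) :
    opM A x k = ∑ i, (A k i : H →L[ℂ] H) (x i) := op_apply _ x k

theorem opM_mul (A : Matrix μ κ M.toStarSubalgebra) (B : Matrix κ ι M.toStarSubalgebra) :
    opM (A * B) = opM A ∘L opM B := by
  rw [opM, opM, opM, ← op_mul]
  congr 1
  exact Matrix.map_mul (f := M.toStarSubalgebra.subtype.toRingHom)

theorem opM_mul_apply (A : Matrix μ κ M.toStarSubalgebra) (B : Matrix κ ι M.toStarSubalgebra)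
    (x : Amp H ι) : opM (A * B) x = opM A (opM B x) := by
  rw [opM_mul]; rfl

theorem opM_sub (A B : Matrix κ ι M.toStarSubalgebra) : opM (A - B) = opM A - opM B := by
  rw [opM, opM, opM, ← op_sub]
  congr 1

theorem opM_add (A B : Matrix κ ι M.toStarSubalgebra) : opM (A + B) = opM A + opM B := by
  rw [opM, opM, opM, ← op_add]
  congr 1

theorem opM_smul (c : ℂ) (A : Matrix κ ι M.toStarSubalgebra) : opM (c • A) = c • opM A := by
  rw [opM, opM, ← op_smul]
  congr 1

theorem opM_zero : opM (0 : Matrix κ ι M.toStarSubalgebra) = 0 := by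
  rw [opM, ← op_zero]
  congr 1

theorem opM_one [DecidableEq ι] :
    opM (1 : Matrix ι ι M.toStarSubalgebra) = ContinuousLinearMap.id ℂ _ := by
  rw [opM, ← op_one]
  congr 1
  exact Matrix.map_one _ rfl rfl

theorem opM_injective : Function.Injective (opM : Matrix κ ι M.toStarSubalgebra → _) :=
  fun _ _ h => Matrix.map_injective Subtype.val_injective (op_injective h)

theorem opM_conjTranspose (A : Matrix κ ι M.toStarSubalgebra) :
    opM A.conjTranspose = ContinuousLinearMap.adjoint (opM A) := by
  rw [opM, opM, ← op_conjTranspose]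
  rfl

/-- The diagonal operator with entries `S`. -/
def diag (ι : Type) [Fintype ι] (S : H →L[ℂ] H) : Amp H ι →L[ℂ] Amp H ι :=
  ((PiLp.continuousLinearEquiv 2 ℂ (fun _ : ι => H)).symm : (ι → H) →L[ℂ] Amp H ι) ∘L
    ContinuousLinearMap.pi fun k => S ∘L PiLp.proj 2 (fun _ : ι => H) k

@[simp] theorem diag_apply (S : H →L[ℂ] H) (x : Amp H ι) (k : ι) :
    diag ι S x k = S (x k) := by
  simp [diag]

theorem diag_inner (S : H →L[ℂ] H) (x y : Amp H ι) :
    inner ℂ (diag ι (star S) y) x = inner ℂ y (diag ι S x) := by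
  simp [PiLp.inner_apply, ContinuousLinearMap.star_eq_adjoint,
    ContinuousLinearMap.adjoint_inner_left]

theorem commute_of_mem_commutant {A S : H →L[ℂ] H} (hA : A ∈ M) (hS : S ∈ M.commutant) (x : H) :
    A (S x) = S (A x) :=
  congrArg (fun f : H →L[ℂ] H => f x) (VonNeumannAlgebra.mem_commutant_iff.1 hS A hA)

theorem mem_of_commute {A : H →L[ℂ] H} (h : ∀ S ∈ M.commutant, ∀ x, A (S x) = S (A x)) :
    A ∈ M := by
  rw [← M.commutant_commutant, VonNeumannAlgebra.mem_commutant_iff]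
  exact fun S hS => ContinuousLinearMap.ext fun x => (h S hS x).symm

theorem opM_diag (A : Matrix κ ι M.toStarSubalgebra) {S : H →L[ℂ] H} (hS : S ∈ M.commutant)
    (x : Amp H ι) : opM A (diag ι S x) = diag κ S (opM A x) := by
  ext k
  simp only [opM_apply, diag_apply, map_sum]
  exact Finset.sum_congr rfl fun i _ => commute_of_mem_commutant (A k i).2 hS _

/-- Each entry of `T` commutes with the commutant, so the bicommutant theorem puts it in `M`. Every
operator constructed below is brought back to a matrix over `M` in this way. -/
theorem exists_opM_eq (T : Amp H ι →L[ℂ] Amp H κ)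
    (hT : ∀ S ∈ M.commutant, ∀ x, T (diag ι S x) = diag κ S (T x)) :
    ∃ A : Matrix κ ι M.toStarSubalgebra, opM A = T := by
  classical
  let inc (i : ι) : H →L[ℂ] Amp H ι :=
    ((PiLp.continuousLinearEquiv 2 ℂ (fun _ : ι => H)).symm : (ι → H) →L[ℂ] Amp H ι) ∘L
      ContinuousLinearMap.single ℂ (fun _ : ι => H) i
  have hinc (i : ι) (h : H) : inc i h = PiLp.single 2 i h := rfl
  let entry (k : κ) (i : ι) : H →L[ℂ] H := PiLp.proj 2 (fun _ : κ => H) k ∘L T ∘L inc i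
  have hentry (k : κ) (i : ι) (h : H) : entry k i h = T (PiLp.single 2 i h) k := rfl
  have hsingle (S : H →L[ℂ] H) (i : ι) (h : H) :
      PiLp.single 2 i (S h) = diag ι S (PiLp.single 2 i h) := by
    ext j
    by_cases hj : j = i
    · subst hj; simp
    · simp [hj]
  have hmem (k : κ) (i : ι) : entry k i ∈ M :=
    mem_of_commute fun S hS x => by rw [hentry, hsingle, hT S hS, diag_apply, hentry]
  refine ⟨Matrix.of fun k i => ⟨entry k i, hmem k i⟩, ?_⟩
  ext x k
  have hx : x = ∑ i, PiLp.single 2 i (x i) := by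
    ext j
    simp [Finset.sum_apply, Pi.single_apply]
  rw [opM_apply]
  conv_rhs => rw [hx, map_sum]
  simp [hentry]

end VN

/-! ### Factorization of bounded operators -/

section Douglas

open Filter Topology

variable {E F G : Type*} [NormedAddCommGroup E] [InnerProductSpace ℂ E] [CompleteSpace E]
  [NormedAddCommGroup F] [InnerProductSpace ℂ F] [CompleteSpace F]
  [NormedAddCommGroup G] [InnerProductSpace ℂ G] [CompleteSpace G]

/-- `D` is injective on the complement of its kernel. This uniqueness yields linearity, continuity
and commutation of Douglas' solution. -/
theorem eq_of_mem_ker_orthogonal (D : F →L[ℂ] G) {y z : F}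
    (hy : y ∈ (LinearMap.ker (D : F →ₗ[ℂ] G))ᗮ)
    (hz : z ∈ (LinearMap.ker (D : F →ₗ[ℂ] G))ᗮ) (h : D y = D z) : y = z := by
  have h1 : y - z ∈ LinearMap.ker (D : F →ₗ[ℂ] G) := by
    rw [LinearMap.mem_ker]
    simp [h]
  have h2 := Submodule.inner_right_of_mem_orthogonal h1 (Submodule.sub_mem _ hy hz)
  exact sub_eq_zero.1 (inner_self_eq_zero.1 h2)

instance completeSpace_ker (D : F →L[ℂ] G) : CompleteSpace (LinearMap.ker (D : F →ₗ[ℂ] G)) :=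
  D.isClosed_ker.completeSpace_coe

/-- Douglas' factorization lemma. -/
theorem exists_factorization (C : E →L[ℂ] G) (D : F →L[ℂ] G)
    (h : ∀ x, ∃ y, D y = C x) :
    ∃ X : E →L[ℂ] F, (∀ x, D (X x) = C x) ∧
      ∀ x, X x ∈ (LinearMap.ker (D : F →ₗ[ℂ] G))ᗮ := by
  have key : ∀ x, ∃ y, D y = C x ∧ y ∈ (LinearMap.ker (D : F →ₗ[ℂ] G))ᗮ := by
    intro x
    obtain ⟨y, hy⟩ := h x
    refine ⟨y - (LinearMap.ker (D : F →ₗ[ℂ] G)).starProjection y, ?_,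
      Submodule.sub_starProjection_mem_orthogonal y⟩
    have := Submodule.starProjection_apply_mem (LinearMap.ker (D : F →ₗ[ℂ] G)) y
    rw [LinearMap.mem_ker] at this
    rw [map_sub, hy]
    exact sub_eq_self.2 this
  choose f hf hf' using key
  let g : E →ₗ[ℂ] F :=
    { toFun := f
      map_add' := fun x y => eq_of_mem_ker_orthogonal D (hf' _)
        (Submodule.add_mem _ (hf' _) (hf' _)) (by simp [hf])
      map_smul' := fun c x => eq_of_mem_ker_orthogonal D (hf' _)
        (Submodule.smul_mem _ _ (hf' _)) (by simp [hf]) }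
  -- Closed graph theorem: a limit `y` of values stays in `(ker D)ᗮ` and satisfies `D y = C x`, so
  -- uniqueness identifies it with the value at `x`.
  have hg : Continuous g := by
    refine g.continuous_of_seq_closed_graph fun w x y hx hy => ?_
    refine eq_of_mem_ker_orthogonal D ?_ (hf' x) ?_
    · exact (Submodule.isClosed_orthogonal _).mem_of_tendsto hy
        (Eventually.of_forall fun n => hf' (w n))
    · refine tendsto_nhds_unique ((D.continuous.tendsto y).comp hy) ?_
      have e : (D ∘ g ∘ w) = C ∘ w := funext fun n => hf (w n)
      rw [e]
      change Tendsto _ _ (𝓝 (D (f x)))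
      rw [hf]
      exact (C.continuous.tendsto x).comp hx
  exact ⟨⟨g, hg⟩, hf, hf'⟩

end Douglas

/-! ### Kernel projections and range inclusions over `M` -/

section VN

variable {H : Type u} [NormedAddCommGroup H] [InnerProductSpace ℂ H] [CompleteSpace H]
variable {M : VonNeumannAlgebra H}
variable {ι κ μ : Type} [Fintype ι] [Fintype κ] [Fintype μ]

theorem diag_mem_orthogonal {W : Submodule ℂ (Amp H ι)}
    (hW : ∀ S ∈ M.commutant, ∀ x ∈ W, diag ι S x ∈ W) {S : H →L[ℂ] H} (hS : S ∈ M.commutant)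
    {x : Amp H ι} (hx : x ∈ Wᗮ) : diag ι S x ∈ Wᗮ := by
  rw [Submodule.mem_orthogonal] at hx ⊢
  intro y hy
  rw [← diag_inner]
  exact hx _ (hW _ (star_mem hS) y hy)

/-- The commutant is closed under adjoints, so `Wᗮ` is invariant as well and the projection commutes
with the diagonal action. -/
theorem exists_opM_eq_starProjection (W : Submodule ℂ (Amp H ι)) [W.HasOrthogonalProjection]
    (hW : ∀ S ∈ M.commutant, ∀ x ∈ W, diag ι S x ∈ W) :
    ∃ P : Matrix ι ι M.toStarSubalgebra, opM P = W.starProjection := by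
  refine exists_opM_eq _ fun S hS x => ?_
  refine Submodule.eq_starProjection_of_mem_orthogonal
    (hW S hS _ (Submodule.starProjection_apply_mem W x)) ?_
  rw [← map_sub]
  exact diag_mem_orthogonal hW hS (Submodule.sub_starProjection_mem_orthogonal x)

/-- The kernel of the operator given by a matrix. -/
abbrev kerM (X : Matrix κ ι M.toStarSubalgebra) : Submodule ℂ (Amp H ι) :=
  LinearMap.ker (opM X : Amp H ι →ₗ[ℂ] Amp H κ)

/-- The range of the operator given by a matrix. -/
abbrev ranM (X : Matrix κ ι M.toStarSubalgebra) : Submodule ℂ (Amp H κ) :=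
  LinearMap.range (opM X : Amp H ι →ₗ[ℂ] Amp H κ)

theorem mem_kerM {X : Matrix κ ι M.toStarSubalgebra} {x : Amp H ι} : x ∈ kerM X ↔ opM X x = 0 :=
  Iff.rfl

theorem mem_ranM {X : Matrix κ ι M.toStarSubalgebra} {y : Amp H κ} :
    y ∈ ranM X ↔ ∃ x, opM X x = y := Iff.rfl

theorem diag_mem_kerM (X : Matrix κ ι M.toStarSubalgebra) {S : H →L[ℂ] H} (hS : S ∈ M.commutant)
    {x : Amp H ι} (hx : x ∈ kerM X) : diag ι S x ∈ kerM X := by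
  rw [mem_kerM] at hx ⊢
  rw [opM_diag X hS, hx, map_zero]

/-- The matrix of the projection onto the kernel. -/
def kerProj (X : Matrix κ ι M.toStarSubalgebra) : Matrix ι ι M.toStarSubalgebra :=
  (exists_opM_eq_starProjection (M := M) (kerM X) fun _ hS _ hx => diag_mem_kerM X hS hx).choose

theorem opM_kerProj (X : Matrix κ ι M.toStarSubalgebra) :
    opM (kerProj X) = (kerM X).starProjection :=
  (exists_opM_eq_starProjection (M := M) (kerM X)
    fun _ hS _ hx => diag_mem_kerM X hS hx).choose_spec

theorem ranM_kerProj (X : Matrix κ ι M.toStarSubalgebra) : ranM (kerProj X) = kerM X := by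
  ext y
  rw [mem_ranM, opM_kerProj]
  constructor
  · rintro ⟨x, rfl⟩
    exact Submodule.starProjection_apply_mem _ _
  · intro hy
    exact ⟨y, Submodule.starProjection_eq_self_iff.2 hy⟩

/-- Douglas' solution with values in `(ker D)ᗮ` is unique, and the diagonal action preserves that
complement. The solution therefore commutes with this action and has entries in `M`. -/
theorem exists_eq_mul_of_ranM_le {C : Matrix κ ι M.toStarSubalgebra}
    {D : Matrix κ μ M.toStarSubalgebra} (h : ranM C ≤ ranM D) :
    ∃ X : Matrix μ ι M.toStarSubalgebra, C = D * X := by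
  obtain ⟨X, hX, hX'⟩ := exists_factorization (opM C) (opM D) fun x => h ⟨x, rfl⟩
  obtain ⟨Y, hY⟩ := exists_opM_eq (M := M) X fun S hS x => by
    refine eq_of_mem_ker_orthogonal (opM D) (hX' _)
      (diag_mem_orthogonal (fun S hS x hx => diag_mem_kerM D hS hx) hS (hX' x)) ?_
    rw [hX, opM_diag D hS, hX, opM_diag C hS]
  refine ⟨Y, opM_injective ?_⟩
  rw [opM_mul, hY]
  exact ContinuousLinearMap.ext fun x => (hX x).symm

theorem ranM_mul_le (D : Matrix κ μ M.toStarSubalgebra) (X : Matrix μ ι M.toStarSubalgebra) :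
    ranM (D * X) ≤ ranM D := by
  rintro _ ⟨x, rfl⟩
  exact ⟨opM X x, (opM_mul_apply D X x).symm⟩

/-- The kernel of `X` is the range of its projection. The right-hand side is an equation over `M`,
which a homomorphism preserving kernel projections respects. -/
theorem kerM_le_iff {ν : Type} [Fintype ν] {X : Matrix κ ι M.toStarSubalgebra}
    {Y : Matrix ν ι M.toStarSubalgebra} : kerM X ≤ kerM Y ↔ Y * kerProj X = 0 := by
  rw [← ranM_kerProj]
  constructor
  · intro h
    apply opM_injective
    rw [opM_zero]
    ext1 x
    rw [opM_mul_apply]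
    exact h ⟨x, rfl⟩
  · rintro h _ ⟨x, rfl⟩
    change opM Y (opM (kerProj X) x) = 0
    rw [← opM_mul_apply, h, opM_zero]
    rfl

end VN

/-! ### Entrywise application of the homomorphism -/

section Morphisms

variable {H : Type u} [NormedAddCommGroup H] [InnerProductSpace ℂ H] [CompleteSpace H]
  {K : Type v} [NormedAddCommGroup K] [InnerProductSpace ℂ K] [CompleteSpace K]
  {M : VonNeumannAlgebra H} {N : VonNeumannAlgebra K}
  (Φ : M.toStarSubalgebra →⋆ₐ[ℂ] N.toStarSubalgebra)
variable {ι κ μ : Type} [Fintype ι] [Fintype κ] [Fintype μ]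

theorem map_mulM (A : Matrix κ μ M.toStarSubalgebra) (B : Matrix μ ι M.toStarSubalgebra) :
    (A * B).map Φ = A.map Φ * B.map Φ := Matrix.map_mul

theorem map_subM (A B : Matrix κ ι M.toStarSubalgebra) : (A - B).map Φ = A.map Φ - B.map Φ :=
  Matrix.map_sub _ (map_sub Φ) A B

theorem map_addM (A B : Matrix κ ι M.toStarSubalgebra) : (A + B).map Φ = A.map Φ + B.map Φ :=
  Matrix.map_add _ (map_add Φ) A B

theorem map_smulM (c : ℂ) (A : Matrix κ ι M.toStarSubalgebra) : (c • A).map Φ = c • A.map Φ :=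
  Matrix.map_smul _ c (map_smul Φ c) A

theorem map_oneM [DecidableEq ι] : (1 : Matrix ι ι M.toStarSubalgebra).map Φ = 1 :=
  Matrix.map_one _ (map_zero Φ) (map_one Φ)

theorem map_zeroM : (0 : Matrix κ ι M.toStarSubalgebra).map Φ = 0 :=
  Matrix.map_zero _ (map_zero Φ)

theorem map_conjTransposeM (A : Matrix κ ι M.toStarSubalgebra) :
    A.conjTranspose.map Φ = (A.map Φ).conjTranspose :=
  Matrix.conjTranspose_map _ (map_star Φ)

/-- The factorization `C = D X` over `M` is algebraic, so normality plays no role here. -/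
theorem ranM_map_le {C : Matrix κ ι M.toStarSubalgebra} {D : Matrix κ μ M.toStarSubalgebra}
    (h : ranM C ≤ ranM D) : ranM (C.map Φ) ≤ ranM (D.map Φ) := by
  obtain ⟨X, rfl⟩ := exists_eq_mul_of_ranM_le h
  rw [map_mulM]
  exact ranM_mul_le _ _

theorem ranM_map_eq {C : Matrix κ ι M.toStarSubalgebra} {D : Matrix κ μ M.toStarSubalgebra}
    (h : ranM C = ranM D) : ranM (C.map Φ) = ranM (D.map Φ) :=
  le_antisymm (ranM_map_le Φ h.le) (ranM_map_le Φ h.ge)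

end Morphisms

/-! ### Resolvents of positive operators -/

section Resolvents

variable {E : Type*} [NormedAddCommGroup E] [InnerProductSpace ℂ E] [CompleteSpace E]

/-- `R` is the resolvent `(T + ε)⁻¹`. -/
structure IsResolvent (T : E →L[ℂ] E) (ε : ℝ) (R : E →L[ℂ] E) : Prop where
  right : ∀ v, T (R v) + (ε : ℂ) • R v = v
  left : ∀ v, R (T v + (ε : ℂ) • v) = v

theorem exists_isResolvent {T : E →L[ℂ] E} (hT : T.IsPositive) {ε : ℝ} (hε : 0 < ε) :
    ∃ R, IsResolvent T ε R := by
  have hu : IsUnit (T + (ε : ℂ) • (1 : E →L[ℂ] E)) := by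
    -- The form of `T + ε` is bounded below: its real part at `x` is at least `ε ‖x‖²`.
    refine ContinuousLinearMap.isUnit_of_forall_le_norm_inner_map _ (c := ⟨ε, hε.le⟩) hε fun x => ?_
    refine le_trans ?_ (RCLike.re_le_norm _)
    have h1 : inner ℂ ((T + (ε : ℂ) • (1 : E →L[ℂ] E)) x) x
        = inner ℂ (T x) x + (ε : ℂ) * ((‖x‖ ^ 2 : ℝ) : ℂ) := by
      simp [inner_self_eq_norm_sq_to_K]
    rw [h1, map_add]
    have h2 : RCLike.re ((ε : ℂ) * ((‖x‖ ^ 2 : ℝ) : ℂ)) = ε * ‖x‖ ^ 2 := by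
      rw [← Complex.ofReal_mul]; exact Complex.ofReal_re _
    rw [h2]
    have h3 := hT.re_inner_nonneg_left x
    change ‖x‖ ^ 2 * ε ≤ _
    linarith
  obtain ⟨w, hw⟩ := hu
  refine ⟨(w⁻¹ : (E →L[ℂ] E)ˣ), fun v => ?_, fun v => ?_⟩
  · have := congrArg (fun f : E →L[ℂ] E => f v) w.mul_inv
    rw [hw] at this
    exact this
  · have := congrArg (fun f : E →L[ℂ] E => f v) w.inv_mul
    rw [hw] at this
    exact this

namespace IsResolvent

variable {T R R' : E →L[ℂ] E} {ε ε' : ℝ}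

theorem commute_apply (hR : IsResolvent T ε R) {S : E →L[ℂ] E} (h : ∀ x, T (S x) = S (T x))
    (v : E) : R (S v) = S (R v) := by
  conv_lhs => rw [← hR.right v]
  rw [map_add, map_smul, ← h, hR.left]

theorem re_inner (T : E →L[ℂ] E) (ε : ℝ) (u : E) :
    RCLike.re (inner ℂ u (T u + (ε : ℂ) • u)) = RCLike.re (inner ℂ u (T u)) + ε * ‖u‖ ^ 2 := by
  rw [inner_add_right, inner_smul_right, map_add, inner_self_eq_norm_sq_to_K]
  congr 1
  change ((ε : ℂ) * ((‖u‖ : ℝ) : ℂ) ^ 2).re = _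
  rw [← Complex.ofReal_pow, ← Complex.ofReal_mul, Complex.ofReal_re]

theorem norm_le (hR : IsResolvent T ε R) (hT : T.IsPositive) (v : E) :
    ε * ‖R v‖ ≤ ‖v‖ := by
  by_cases h0 : ‖R v‖ = 0
  · rw [h0, mul_zero]; exact norm_nonneg v
  have h0 : 0 < ‖R v‖ := lt_of_le_of_ne (norm_nonneg _) (Ne.symm h0)
  have h1 := re_inner T ε (R v)
  rw [hR.right] at h1
  have h2 : RCLike.re (inner ℂ (R v) v) ≤ ‖R v‖ * ‖v‖ := re_inner_le_norm _ _
  have h3 := hT.re_inner_nonneg_right (R v)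
  have : ‖R v‖ * (ε * ‖R v‖) ≤ ‖R v‖ * ‖v‖ := by nlinarith
  exact le_of_mul_le_mul_left this h0

/-- Since `ε R = 1 - T R`, it suffices to compare `T R` with `T R'`. The resolvent identity `R - R'
= (ε' - ε) R R'` reduces this to positivity of `T R R'`. -/
theorem re_inner_mono (hR : IsResolvent T ε R) (hR' : IsResolvent T ε' R') (hT : T.IsPositive)
    (hε : 0 < ε) (h : ε ≤ ε') (v : E) :
    ε * RCLike.re (inner ℂ (R v) v) ≤ ε' * RCLike.re (inner ℂ (R' v) v) := by
  have hb : R v = R' v + ((ε' - ε : ℝ) : ℂ) • R (R' v) := by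
    have : v = (T (R' v) + (ε : ℂ) • R' v) + ((ε' - ε : ℝ) : ℂ) • R' v := by
      conv_lhs => rw [← hR'.right v]
      rw [Complex.ofReal_sub, sub_smul]
      abel
    conv_lhs => rw [this]
    rw [map_add, hR.left, map_smul]
  have e1 : ∀ (δ : ℝ) (S : E →L[ℂ] E), IsResolvent T δ S →
      δ * RCLike.re (inner ℂ (S v) v) = ‖v‖ ^ 2 - RCLike.re (inner ℂ (T (S v)) v) := by
    intro δ S hS
    have h1 : (δ : ℂ) • S v = v - T (S v) := eq_sub_of_add_eq' (hS.right v)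
    have h2 : inner ℂ ((δ : ℂ) • S v) v = (δ : ℂ) * inner ℂ (S v) v := by
      rw [inner_smul_left]; simp
    have h3 : RCLike.re ((δ : ℂ) * inner ℂ (S v) v) = δ * RCLike.re (inner ℂ (S v) v) :=
      RCLike.re_ofReal_mul (K := ℂ) _ _
    rw [← h3, ← h2, h1, inner_sub_left, map_sub, inner_self_eq_norm_sq]
  rw [e1 _ _ hR, e1 _ _ hR', hb, map_add, map_smul, inner_add_left, inner_smul_left, map_add]
  have e2 : RCLike.re ((starRingEnd ℂ) ((ε' - ε : ℝ) : ℂ) * inner ℂ (T (R (R' v))) v)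
      = (ε' - ε) * RCLike.re (inner ℂ (T (R (R' v))) v) := by
    rw [Complex.conj_ofReal]
    exact RCLike.re_ofReal_mul (K := ℂ) _ _
  rw [e2]
  have e3 : 0 ≤ RCLike.re (inner ℂ (T (R (R' v))) v) := by
    -- with `c = R (R' v)` and `T` commuting with the resolvents, `v = (T + ε') (T + ε) c`
    set c := R (R' v) with hc
    have hc1 : R' v = T c + (ε : ℂ) • c := (hR.right (R' v)).symm
    have hv : v = T (T c + (ε : ℂ) • c) + (ε' : ℂ) • (T c + (ε : ℂ) • c) := by
      rw [← hc1]; exact (hR'.right v).symm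
    have h4 : inner ℂ (T c) v = inner ℂ (T c) (T (T c)) + ((ε + ε' : ℝ) : ℂ) * inner ℂ (T c) (T c)
        + ((ε' * ε : ℝ) : ℂ) * inner ℂ (T c) c := by
      conv_lhs => rw [hv]
      simp only [map_add, map_smul, inner_add_right, inner_smul_right, smul_add]
      push_cast
      ring
    rw [h4, map_add, map_add]
    have h5 : RCLike.re (((ε + ε' : ℝ) : ℂ) * inner ℂ (T c) (T c)) = (ε + ε') * ‖T c‖ ^ 2 := by
      rw [← inner_self_eq_norm_sq (𝕜 := ℂ)]
      exact RCLike.re_ofReal_mul (K := ℂ) _ _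
    have h6 : RCLike.re (((ε' * ε : ℝ) : ℂ) * inner ℂ (T c) c)
        = ε' * ε * RCLike.re (inner ℂ (T c) c) := RCLike.re_ofReal_mul (K := ℂ) _ _
    rw [h5, h6]
    have h7 := hT.re_inner_nonneg_right (T c)
    have h8 := hT.re_inner_nonneg_left c
    have : 0 < ε' := hε.trans_le h
    positivity
  nlinarith

theorem smul_apply_of_mem_ker (hR : IsResolvent T ε R) {v : E} (hv : T v = 0) :
    (ε : ℂ) • R v = v := by
  rw [← map_smul]
  have := hR.left v
  rwa [hv, zero_add] at this

/-- As `P T = 0`, applying `P` to `v = T u + ε u` gives `P v = ε P u`. Hence `‖P v‖² ≤ ε² ‖u‖² ≤ ε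
Re ⟪u, v⟫`. -/
theorem re_inner_starProjection_le (hR : IsResolvent T ε R) (hT : T.IsPositive) (hε : 0 < ε)
    (v : E) :
    RCLike.re (inner ℂ ((LinearMap.ker (T : E →ₗ[ℂ] E)).starProjection v) v) ≤
      ε * RCLike.re (inner ℂ (R v) v) := by
  set P := (LinearMap.ker (T : E →ₗ[ℂ] E)).starProjection with hP
  have hu := hR.right v
  set u := R v with hu'
  have hPT : ∀ x, P (T x) = 0 := fun x => by
    rw [hP, Submodule.starProjection_apply_eq_zero_iff, Submodule.mem_orthogonal]
    intro y hy
    rw [← hT.inner_left_eq_inner_right]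
    have : T y = 0 := hy
    rw [this, inner_zero_left]
  have h1 : (ε : ℂ) • P u = P v := by
    rw [← hu, map_add, hPT, zero_add, map_smul]
  have h2 : RCLike.re (inner ℂ (P v) v) = ‖P v‖ ^ 2 := by
    rw [hP, Submodule.re_inner_starProjection_eq_normSq]
    rfl
  have h3 := re_inner T ε u
  rw [hu] at h3
  have h4 := hT.re_inner_nonneg_right u
  have h5 : ‖P v‖ = ε * ‖P u‖ := by
    rw [← h1, norm_smul, Complex.norm_real, Real.norm_of_nonneg hε.le]
  have h6 : ‖P u‖ ≤ ‖u‖ := Submodule.norm_starProjection_apply_le _ _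
  rw [h2, h3, h5]
  have h7 : ‖P u‖ ^ 2 ≤ ‖u‖ ^ 2 := by gcongr
  nlinarith [mul_nonneg hε.le h4, mul_le_mul_of_nonneg_left h7 (sq_nonneg ε)]

end IsResolvent

/-- The operators `ε (T + ε)⁻¹` converge strongly to the projection onto the kernel of `T`. -/
theorem exists_norm_resolvent_sub_le {T : E →L[ℂ] E} (hT : T.IsPositive) (v : E) {δ : ℝ}
    (hδ : 0 < δ) : ∃ ε : ℝ, 0 < ε ∧ ∀ R, IsResolvent T ε R →
      ‖(ε : ℂ) • R v - (LinearMap.ker (T : E →ₗ[ℂ] E)).starProjection v‖ ≤ δ := by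
  set P := (LinearMap.ker (T : E →ₗ[ℂ] E)).starProjection with hP
  -- `T` is self-adjoint, so the complement of its kernel is the closure of its range. There `v - P
  -- v` is within `δ / 2` of some `T w`.
  have hmem : v - P v ∈ (LinearMap.range (T : E →ₗ[ℂ] E)).topologicalClosure := by
    have h1 : v - P v ∈ (LinearMap.ker (T : E →ₗ[ℂ] E))ᗮ :=
      Submodule.sub_starProjection_mem_orthogonal v
    have h2 := T.orthogonal_ker
    rw [hT.isSelfAdjoint.adjoint_eq] at h2
    exact h2 ▸ h1
  obtain ⟨_, ⟨w, rfl⟩, hw⟩ := Metric.mem_closure_iff.1 hmem (δ / 2) (by positivity)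
  rw [dist_eq_norm] at hw
  change ‖v - P v - T w‖ < _ at hw
  -- On `T w` the operator gives `ε (w - ε R w)`, of norm at most `2 ε ‖w‖`; this `ε` makes it at
  -- most `δ / 2`. The `+ 1` covers `w = 0`.
  refine ⟨δ / (4 * (‖w‖ + 1)), by positivity, fun R hR => ?_⟩
  set ε := δ / (4 * (‖w‖ + 1)) with hε'
  have hε : 0 < ε := by positivity
  have e : (ε : ℂ) • R v - P v = (ε : ℂ) • R (v - P v - T w) + (ε : ℂ) • (w - (ε : ℂ) • R w) := by
    have h1 : (ε : ℂ) • R (P v) = P v := hR.smul_apply_of_mem_ker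
      (Submodule.starProjection_apply_mem (LinearMap.ker (T : E →ₗ[ℂ] E)) v)
    have h2 : R (T w) = w - (ε : ℂ) • R w := by
      rw [eq_sub_iff_add_eq, ← map_smul, ← map_add, hR.left]
    rw [map_sub, map_sub, h2, smul_sub, smul_sub, h1]
    abel
  have hsm (x : E) : ‖(ε : ℂ) • x‖ = ε * ‖x‖ := by
    rw [norm_smul, Complex.norm_real, Real.norm_of_nonneg hε.le]
  rw [e]
  have b1 : ‖(ε : ℂ) • R (v - P v - T w)‖ ≤ δ / 2 := by
    rw [hsm]
    exact (hR.norm_le hT _).trans hw.le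
  have b2 : ‖(ε : ℂ) • (w - (ε : ℂ) • R w)‖ ≤ δ / 2 := by
    rw [hsm]
    have h3 : ‖w - (ε : ℂ) • R w‖ ≤ 2 * ‖w‖ := by
      refine (norm_sub_le _ _).trans ?_
      rw [hsm]
      linarith [hR.norm_le hT w]
    have h4 : ε * (4 * (‖w‖ + 1)) = δ := by
      rw [hε']; field_simp
    nlinarith [norm_nonneg w]
  linarith [norm_add_le ((ε : ℂ) • R (v - P v - T w)) ((ε : ℂ) • (w - (ε : ℂ) • R w))]

end Resolvents

/-! ### Kernel projections as suprema of resolvent expressions -/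

section VN

variable {H : Type u} [NormedAddCommGroup H] [InnerProductSpace ℂ H] [CompleteSpace H]
variable {M : VonNeumannAlgebra H}
variable {ι κ μ : Type} [Fintype ι] [Fintype κ] [Fintype μ]

theorem isResolvent_opM_iff [DecidableEq ι] {T R : Matrix ι ι M.toStarSubalgebra} {ε : ℝ} :
    IsResolvent (opM T) ε (opM R) ↔
      T * R + (ε : ℂ) • R = 1 ∧ R * T + (ε : ℂ) • R = 1 := by
  have e1 : opM (T * R + (ε : ℂ) • R) = opM T ∘L opM R + (ε : ℂ) • opM R := by
    rw [opM_add, opM_mul, opM_smul]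
  have e2 : opM (R * T + (ε : ℂ) • R) = opM R ∘L opM T + (ε : ℂ) • opM R := by
    rw [opM_add, opM_mul, opM_smul]
  constructor
  · intro h
    constructor
    · apply opM_injective
      rw [e1, opM_one]
      exact ContinuousLinearMap.ext h.right
    · apply opM_injective
      rw [e2, opM_one]
      refine ContinuousLinearMap.ext fun v => ?_
      have := h.left v
      rwa [map_add, map_smul] at this
  · rintro ⟨h1, h2⟩
    rw [← opM_injective.eq_iff, e1, opM_one] at h1
    rw [← opM_injective.eq_iff, e2, opM_one] at h2
    refine ⟨fun v => congrArg (fun f : Amp H ι →L[ℂ] Amp H ι => f v) h1, fun v => ?_⟩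
    rw [map_add, map_smul]
    exact congrArg (fun f : Amp H ι →L[ℂ] Amp H ι => f v) h2

theorem isPositive_opM_gram (X : Matrix κ ι M.toStarSubalgebra) :
    (opM (X.conjTranspose * X)).IsPositive := by
  rw [opM_mul, opM_conjTranspose]
  exact ContinuousLinearMap.isPositive_adjoint_comp_self _

theorem kerM_gram (X : Matrix κ ι M.toStarSubalgebra) : kerM (X.conjTranspose * X) = kerM X := by
  ext x
  rw [mem_kerM, mem_kerM, opM_mul_apply, opM_conjTranspose]
  constructor
  · intro h
    have : inner ℂ (opM X x) (opM X x) = (0 : ℂ) := by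
      rw [← ContinuousLinearMap.adjoint_inner_left, h, inner_zero_left]
    exact inner_self_eq_zero.1 this
  · intro h
    rw [h, map_zero]

theorem opM_kerProj_gram (X : Matrix κ ι M.toStarSubalgebra) :
    opM (kerProj X) = (kerM (X.conjTranspose * X)).starProjection := by
  rw [opM_kerProj]
  congr 1
  exact (kerM_gram X).symm

theorem exists_matrix_isResolvent (X : Matrix κ ι M.toStarSubalgebra) {ε : ℝ} (hε : 0 < ε) :
    ∃ R : Matrix ι ι M.toStarSubalgebra, IsResolvent (opM (X.conjTranspose * X)) ε (opM R) := by
  obtain ⟨R, hR⟩ := exists_isResolvent (isPositive_opM_gram X) hε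
  obtain ⟨A, rfl⟩ := exists_opM_eq (M := M) R fun S hS =>
    hR.commute_apply fun x => opM_diag _ hS x
  exact ⟨A, hR⟩

/-- Taking adjoints turns the left inverse `R` of `T + ε` into a right inverse, and a left and a
right inverse coincide. -/
theorem conjTranspose_eq_of_isResolvent [DecidableEq ι] {T R : Matrix ι ι M.toStarSubalgebra}
    {ε : ℝ} (hT : T.conjTranspose = T) (h : IsResolvent (opM T) ε (opM R)) :
    R.conjTranspose = R := by
  obtain ⟨h1, h2⟩ := isResolvent_opM_iff.1 h
  have h3 := congrArg Matrix.conjTranspose h2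
  rw [Matrix.conjTranspose_add, Matrix.conjTranspose_mul, Matrix.conjTranspose_smul, hT,
    Matrix.conjTranspose_one, Complex.star_def, Complex.conj_ofReal] at h3
  calc R.conjTranspose = (R * T + (ε : ℂ) • R) * R.conjTranspose := by rw [h2, one_mul]
    _ = R * (T * R.conjTranspose + (ε : ℂ) • R.conjTranspose) := by
      rw [Matrix.add_mul, Matrix.mul_add, Matrix.mul_assoc, Matrix.smul_mul, Matrix.mul_smul]
    _ = R := by rw [h3, mul_one]

theorem kerProj_conjTranspose (X : Matrix κ ι M.toStarSubalgebra) :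
    (kerProj X).conjTranspose = kerProj X := by
  apply opM_injective
  rw [opM_conjTranspose, opM_kerProj]
  exact (Submodule.starProjection_isSymmetric (kerM X)).isSelfAdjoint.adjoint_eq

theorem kerProj_mul_of_ranM_le {X : Matrix κ ι M.toStarSubalgebra}
    {Y : Matrix ι μ M.toStarSubalgebra} (h : ranM Y ≤ kerM X) : kerProj X * Y = Y := by
  apply opM_injective
  ext1 x
  rw [opM_mul_apply, opM_kerProj]
  exact Submodule.starProjection_eq_self_iff.2 (h ⟨x, rfl⟩)

theorem kerProj_mul_self (X : Matrix κ ι M.toStarSubalgebra) :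
    kerProj X * kerProj X = kerProj X :=
  kerProj_mul_of_ranM_le (ranM_kerProj X).le

theorem mul_kerProj (X : Matrix κ ι M.toStarSubalgebra) : X * kerProj X = 0 :=
  kerM_le_iff.1 le_rfl

theorem ranM_le_kerM {X : Matrix κ ι M.toStarSubalgebra}
    {Y : Matrix ι μ M.toStarSubalgebra} (h : X * Y = 0) : ranM Y ≤ kerM X := by
  rintro _ ⟨x, rfl⟩
  change opM X (opM Y x) = 0
  rw [← opM_mul_apply, h, opM_zero]
  rfl

theorem inner_opM_single [DecidableEq ι] (A : Matrix ι ι M.toStarSubalgebra) (i : ι) (h : H) :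
    inner ℂ (opM A (PiLp.single 2 i h)) (PiLp.single 2 i h) =
      inner ℂ ((A i i : H →L[ℂ] H) h) h := by
  rw [PiLp.inner_apply, Finset.sum_eq_single i]
  · rw [opM, op_single]
    simp
  · intro j _ hj
    simp [hj]
  · simp

/-- The order is the Loewner order. Self-adjointness of the difference is assumed because real parts
of the form do not detect it. -/
theorem le_iff_re_inner {a b : M.toStarSubalgebra} (h : IsSelfAdjoint (b - a)) :
    a ≤ b ↔ ∀ x, RCLike.re (inner ℂ ((a : H →L[ℂ] H) x) x) ≤
      RCLike.re (inner ℂ ((b : H →L[ℂ] H) x) x) := by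
  have h' : IsSelfAdjoint ((b : H →L[ℂ] H) - (a : H →L[ℂ] H)) := congrArg Subtype.val h
  change (((b : H →L[ℂ] H) - (a : H →L[ℂ] H)).IsPositive) ↔ _
  rw [ContinuousLinearMap.isPositive_def', and_iff_right h']
  refine forall_congr' fun x => ?_
  rw [ContinuousLinearMap.reApplyInnerSelf_apply, sub_apply, inner_sub_left,
    map_sub, sub_nonneg]

theorem isSelfAdjoint_sub_of_le {a b : M.toStarSubalgebra} (h : a ≤ b) :
    IsSelfAdjoint (b - a) := by
  have : ((b : H →L[ℂ] H) - (a : H →L[ℂ] H)).IsPositive := h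
  exact Subtype.ext this.isSelfAdjoint

theorem isSelfAdjoint_diag_entry {A : Matrix ι ι M.toStarSubalgebra} (h : A.conjTranspose = A)
    (i : ι) : IsSelfAdjoint (A i i) := by
  have := congrFun (congrFun h i) i
  rwa [Matrix.conjTranspose_apply] at this

theorem one_sub_smul_conjTranspose [DecidableEq ι] {R : Matrix ι ι M.toStarSubalgebra} {ε : ℝ}
    (h : R.conjTranspose = R) : (1 - (ε : ℂ) • R).conjTranspose = 1 - (ε : ℂ) • R := by
  rw [Matrix.conjTranspose_sub, Matrix.conjTranspose_smul, h, Matrix.conjTranspose_one,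
    Complex.star_def, Complex.conj_ofReal]

theorem one_sub_kerProj_conjTranspose [DecidableEq ι] (X : Matrix κ ι M.toStarSubalgebra) :
    (1 - kerProj X).conjTranspose = 1 - kerProj X := by
  rw [Matrix.conjTranspose_sub, kerProj_conjTranspose, Matrix.conjTranspose_one]

theorem re_inner_one_sub_smul [DecidableEq ι] (R : Matrix ι ι M.toStarSubalgebra) (ε : ℝ) (i : ι)
    (x : H) :
    RCLike.re (inner ℂ ((((1 - (ε : ℂ) • R) i i : M.toStarSubalgebra) : H →L[ℂ] H) x) x) =
      ‖x‖ ^ 2 - ε * RCLike.re (inner ℂ (opM R (PiLp.single 2 i x)) (PiLp.single 2 i x)) := by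
  rw [inner_opM_single]
  have e : ((((1 - (ε : ℂ) • R) i i : M.toStarSubalgebra) : H →L[ℂ] H) x) =
      x - (ε : ℂ) • (R i i : H →L[ℂ] H) x := by
    simp
  rw [e, inner_sub_left, inner_smul_left, map_sub, inner_self_eq_norm_sq, Complex.conj_ofReal]
  congr 1
  exact RCLike.re_ofReal_mul (K := ℂ) _ _

theorem re_inner_one_sub [DecidableEq ι] (P : Matrix ι ι M.toStarSubalgebra) (i : ι) (x : H) :
    RCLike.re (inner ℂ ((((1 - P) i i : M.toStarSubalgebra) : H →L[ℂ] H) x) x) =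
      ‖x‖ ^ 2 - RCLike.re (inner ℂ (opM P (PiLp.single 2 i x)) (PiLp.single 2 i x)) := by
  rw [inner_opM_single]
  have e : ((((1 - P) i i : M.toStarSubalgebra) : H →L[ℂ] H) x) =
      x - (P i i : H →L[ℂ] H) x := by
    simp
  rw [e, inner_sub_left, map_sub, inner_self_eq_norm_sq]

/-- The diagonal entries of the matrices `1 - ε (Xᴴ X + ε)⁻¹`. -/
def approx [DecidableEq ι] (X : Matrix κ ι M.toStarSubalgebra) (i : ι) : Set M.toStarSubalgebra :=
  {a | ∃ ε : ℝ, 0 < ε ∧ ∃ R : Matrix ι ι M.toStarSubalgebra,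
    IsResolvent (opM (X.conjTranspose * X)) ε (opM R) ∧ a = (1 - (ε : ℂ) • R) i i}

variable [DecidableEq ι] (X : Matrix κ ι M.toStarSubalgebra) (i : ι)

theorem conjTranspose_gram : (X.conjTranspose * X).conjTranspose = X.conjTranspose * X := by
  rw [Matrix.conjTranspose_mul, Matrix.conjTranspose_conjTranspose]

theorem isSelfAdjoint_of_mem_approx {a : M.toStarSubalgebra} (h : a ∈ approx X i) :
    IsSelfAdjoint a := by
  obtain ⟨ε, hε, R, hR, rfl⟩ := h
  exact isSelfAdjoint_diag_entry
    (one_sub_smul_conjTranspose (conjTranspose_eq_of_isResolvent (conjTranspose_gram X) hR)) i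

theorem approx_nonempty : (approx X i).Nonempty := by
  obtain ⟨R, hR⟩ := exists_matrix_isResolvent X one_pos
  exact ⟨_, 1, one_pos, R, hR, rfl⟩

/-- The approximants decrease as `ε` grows, so they form a chain. This supplies the directedness
that normality asks for. -/
theorem approx_total {a b : M.toStarSubalgebra} (ha : a ∈ approx X i) (hb : b ∈ approx X i) :
    a ≤ b ∨ b ≤ a := by
  have hsa := isSelfAdjoint_of_mem_approx X i ha
  have hsb := isSelfAdjoint_of_mem_approx X i hb
  obtain ⟨ε, hε, R, hR, rfl⟩ := ha
  obtain ⟨ε', hε', R', hR', rfl⟩ := hb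
  rcases le_total ε ε' with h | h
  · right
    rw [le_iff_re_inner (hsa.sub hsb)]
    intro x
    rw [re_inner_one_sub_smul, re_inner_one_sub_smul]
    have := hR.re_inner_mono hR' (isPositive_opM_gram X) hε h (PiLp.single 2 i x)
    linarith
  · left
    rw [le_iff_re_inner (hsb.sub hsa)]
    intro x
    rw [re_inner_one_sub_smul, re_inner_one_sub_smul]
    have := hR'.re_inner_mono hR (isPositive_opM_gram X) hε' h (PiLp.single 2 i x)
    linarith

theorem directedOn_approx : DirectedOn (· ≤ ·) (approx X i) := by
  intro a ha b hb
  rcases approx_total X i ha hb with h | h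
  · exact ⟨b, hb, h, le_rfl⟩
  · exact ⟨a, ha, le_rfl, h⟩

theorem le_of_mem_approx {a : M.toStarSubalgebra} (ha : a ∈ approx X i) :
    a ≤ (1 - kerProj X) i i := by
  have hsa := isSelfAdjoint_of_mem_approx X i ha
  obtain ⟨ε, hε, R, hR, rfl⟩ := ha
  rw [le_iff_re_inner ((isSelfAdjoint_diag_entry (one_sub_kerProj_conjTranspose X) i).sub hsa)]
  intro x
  rw [re_inner_one_sub_smul, re_inner_one_sub, opM_kerProj_gram]
  have := hR.re_inner_starProjection_le (isPositive_opM_gram X) hε (PiLp.single 2 i x)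
  linarith

/-- `ε R` converges strongly to the kernel projection, so a bound valid for every approximant
survives in the limit. Diagonal entries are used because normality concerns elements of `M`, not
matrices. -/
theorem isLUB_approx : IsLUB (approx X i) ((1 - kerProj X) i i) := by
  refine ⟨fun a ha => le_of_mem_approx X i ha, fun b hb => ?_⟩
  -- An upper bound differs from a self-adjoint approximant by a positive element.
  have hsb : IsSelfAdjoint b := by
    obtain ⟨a, ha⟩ := approx_nonempty X i
    have := (isSelfAdjoint_sub_of_le (hb ha)).add (isSelfAdjoint_of_mem_approx X i ha)
    rwa [sub_add_cancel] at this
  rw [le_iff_re_inner (hsb.sub (isSelfAdjoint_diag_entry (one_sub_kerProj_conjTranspose X) i))]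
  intro x
  rw [re_inner_one_sub, opM_kerProj_gram]
  refine le_of_forall_pos_le_add fun δ hδ => ?_
  set v : Amp H ι := PiLp.single 2 i x
  obtain ⟨ε, hε, hconv⟩ := exists_norm_resolvent_sub_le (isPositive_opM_gram X) v
    (δ := δ / (‖v‖ + 1)) (by positivity)
  obtain ⟨R, hR⟩ := exists_matrix_isResolvent X hε
  have h1 := hb ⟨ε, hε, R, hR, rfl⟩
  have h2 := (le_iff_re_inner (isSelfAdjoint_sub_of_le h1)).1 h1 x
  rw [re_inner_one_sub_smul] at h2
  have h3 := hconv _ hR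
  set p := (kerM (X.conjTranspose * X)).starProjection v
  have h4 : RCLike.re (inner ℂ ((ε : ℂ) • opM R v - p) v) ≤ δ := by
    refine (re_inner_le_norm _ _).trans ?_
    calc _ ≤ δ / (‖v‖ + 1) * (‖v‖ + 1) := by gcongr; linarith
      _ = δ := by field_simp
  rw [inner_sub_left, map_sub, inner_smul_left, Complex.conj_ofReal] at h4
  have h5 : RCLike.re ((ε : ℂ) * inner ℂ (opM R v) v) = ε * RCLike.re (inner ℂ (opM R v) v) :=
    RCLike.re_ofReal_mul (K := ℂ) _ _
  rw [h5] at h4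
  linarith

end VN

/-! ### Normal homomorphisms preserve kernel projections -/

section Morphisms

variable {H : Type u} [NormedAddCommGroup H] [InnerProductSpace ℂ H] [CompleteSpace H]
  {K : Type v} [NormedAddCommGroup K] [InnerProductSpace ℂ K] [CompleteSpace K]
  {M : VonNeumannAlgebra H} {N : VonNeumannAlgebra K}
  {Φ : M.toStarSubalgebra →⋆ₐ[ℂ] N.toStarSubalgebra}
variable {ι κ μ : Type} [Fintype ι] [Fintype κ] [Fintype μ]

/-- A resolvent is characterized by two algebraic equations, which `Φ` preserves. -/
theorem map_mem_approx [DecidableEq ι] {X : Matrix κ ι M.toStarSubalgebra} {i : ι}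
    {a : M.toStarSubalgebra} (ha : a ∈ approx X i) : Φ a ∈ approx (X.map Φ) i := by
  obtain ⟨ε, hε, R, hR, rfl⟩ := ha
  refine ⟨ε, hε, R.map Φ, ?_, ?_⟩
  · rw [isResolvent_opM_iff] at hR ⊢
    rw [← map_conjTransposeM, ← map_mulM, ← map_mulM, ← map_mulM, ← map_smulM, ← map_addM,
      ← map_addM, hR.1, hR.2, map_oneM]
    exact ⟨rfl, rfl⟩
  · rw [← map_smulM, ← map_oneM (ι := ι) Φ, ← map_subM]
    rfl

/-- A normal homomorphism preserves projections onto kernels. -/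
theorem map_kerProj (hΦ : IsNormalHom Φ) (X : Matrix κ ι M.toStarSubalgebra) :
    (kerProj X).map Φ = kerProj (X.map Φ) := by
  classical
  -- The only use of normality: the image of the supremum is the supremum of the images, and these
  -- are approximants for `X.map Φ`.
  have hdiag : ∀ i, Φ ((1 - kerProj X) i i) ≤ (1 - kerProj (X.map Φ)) i i := fun i =>
    (hΦ _ _ (approx_nonempty X i) (directedOn_approx X i)
      (fun a ha => isSelfAdjoint_of_mem_approx X i ha) (isLUB_approx X i)).2 (by
        rintro _ ⟨a, ha, rfl⟩
        exact le_of_mem_approx _ i (map_mem_approx ha))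
  set P := (kerProj X).map Φ with hP
  set P' := kerProj (X.map Φ) with hP'
  have hPs : P.conjTranspose = P := by
    rw [hP, ← map_conjTransposeM, kerProj_conjTranspose]
  have hPP : P * P = P := by rw [hP, ← map_mulM, kerProj_mul_self]
  -- `X` annihilates its kernel projection, hence `P` is a subprojection of `P'`, and `P' - P` is
  -- itself a projection.
  have h1 : P' * P = P := kerProj_mul_of_ranM_le (ranM_le_kerM (by
    rw [hP, ← map_mulM, mul_kerProj, map_zeroM]))
  have h2 : P * P' = P := by
    have := congrArg Matrix.conjTranspose h1
    rwa [Matrix.conjTranspose_mul, hPs, hP', kerProj_conjTranspose] at this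
  have hWs : (P' - P).conjTranspose = P' - P := by
    rw [Matrix.conjTranspose_sub, hPs, hP', kerProj_conjTranspose]
  have hWW : (P' - P) * (P' - P) = P' - P := by
    rw [Matrix.sub_mul, Matrix.mul_sub, Matrix.mul_sub, h1, h2, hPP, kerProj_mul_self]
    abel
  have hz : ∀ (i : ι) (x : K), opM (P' - P) (PiLp.single 2 i x) = 0 := by
    intro i x
    have h3 := (le_iff_re_inner (isSelfAdjoint_sub_of_le (hdiag i))).1 (hdiag i) x
    have e : Φ ((1 - kerProj X) i i) = (1 - P) i i := by
      rw [hP, ← map_oneM (ι := ι) Φ, ← map_subM]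
      rfl
    rw [e, re_inner_one_sub, re_inner_one_sub] at h3
    -- For a projection `W`, `‖W v‖² = ⟪W v, v⟫`. With `v` supported in one coordinate this sees a
    -- single diagonal entry, which `hdiag` makes nonpositive.
    have h4 : ‖opM (P' - P) (PiLp.single 2 i x)‖ ^ 2 =
        RCLike.re (inner ℂ (opM (P' - P) (PiLp.single 2 i x)) (PiLp.single 2 i x)) := by
      conv_rhs => rw [← hWW]
      rw [opM_mul_apply]
      nth_rewrite 2 [← hWs]
      rw [opM_conjTranspose, ContinuousLinearMap.adjoint_inner_left, inner_self_eq_norm_sq]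
    rw [opM_sub, sub_apply, inner_sub_left, map_sub] at h4
    rw [opM_sub, sub_apply]
    have h5 : ‖opM P' (PiLp.single 2 i x) - opM P (PiLp.single 2 i x)‖ ^ 2 ≤ 0 := by linarith
    exact norm_eq_zero.1 (pow_eq_zero_iff two_ne_zero |>.1 (le_antisymm h5 (sq_nonneg _)))
  have hW : P' - P = 0 := by
    ext k i x
    have := congrArg (fun y : Amp K ι => y k) (hz i x)
    rw [opM, op_single] at this
    exact this
  exact (sub_eq_zero.1 hW).symm

theorem kerM_map_le (hΦ : IsNormalHom Φ) {X : Matrix κ ι M.toStarSubalgebra}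
    {Y : Matrix μ ι M.toStarSubalgebra} (h : kerM X ≤ kerM Y) :
    kerM (X.map Φ) ≤ kerM (Y.map Φ) := by
  rw [kerM_le_iff] at h ⊢
  rw [← map_kerProj hΦ, ← map_mulM, h, map_zeroM]

end Morphisms

/-! ### Graphs as ranges of matrices -/

section VN

variable {H : Type u} [NormedAddCommGroup H] [InnerProductSpace ℂ H] [CompleteSpace H]
variable {M : VonNeumannAlgebra H}
variable {ι κ μ : Type} [Fintype ι] [Fintype κ] [Fintype μ]

/-- A pair of vectors, as an element of the Hilbert sum of two copies of `H`. -/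
def pair (x y : H) : Amp H (Fin 2) := WithLp.toLp 2 ![x, y]

@[simp] theorem pair_zero (x y : H) : pair x y 0 = x := rfl

@[simp] theorem pair_one (x y : H) : pair x y 1 = y := rfl

theorem eq_pair (v : Amp H (Fin 2)) : v = pair (v 0) (v 1) := by
  ext i
  fin_cases i <;> rfl

theorem eq_pair_iff {v : Amp H (Fin 2)} {x y : H} : v = pair x y ↔ v 0 = x ∧ v 1 = y := by
  constructor
  · rintro rfl
    exact ⟨rfl, rfl⟩
  · rintro ⟨rfl, rfl⟩
    exact eq_pair v

theorem continuous_pair : Continuous fun p : H × H => pair p.1 p.2 := by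
  refine (PiLp.continuous_toLp 2 (fun _ : Fin 2 => H)).comp (continuous_pi fun i => ?_)
  fin_cases i
  · exact continuous_fst
  · exact continuous_snd

theorem continuous_coords : Continuous fun v : Amp H (Fin 2) => (v 0, v 1) :=
  (PiLp.continuous_apply 2 (fun _ : Fin 2 => H) 0).prodMk
    (PiLp.continuous_apply 2 (fun _ : Fin 2 => H) 1)

/-- The graph of `T` is the range of the matrix `C` with two rows. -/
def Represents (C : Matrix (Fin 2) ι M.toStarSubalgebra) (T : H →ₗ.[ℂ] H) : Prop :=
  ∀ x y, (x, y) ∈ T.graph ↔ pair x y ∈ ranM C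

/-- The matrix with a single column. -/
def col (b a : M.toStarSubalgebra) : Matrix (Fin 2) (Fin 1) M.toStarSubalgebra := !![b; a]

theorem pair_mem_ranM_col {b a : M.toStarSubalgebra} {x y : H} :
    pair x y ∈ ranM (col b a) ↔ ∃ w : H, (b : H →L[ℂ] H) w = x ∧ (a : H →L[ℂ] H) w = y := by
  rw [mem_ranM]
  constructor
  · rintro ⟨w, hw⟩
    rw [eq_pair_iff] at hw
    refine ⟨w 0, ?_⟩
    simpa [opM_apply, col] using hw
  · rintro ⟨w, h1, h2⟩
    refine ⟨WithLp.toLp 2 ![w], ?_⟩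
    rw [eq_pair_iff]
    simp [opM_apply, col, h1, h2]

theorem represents_col_iff {b a : M.toStarSubalgebra} {T : H →ₗ.[ℂ] H} :
    Represents (col b a) T ↔ ∀ x y, (x, y) ∈ T.graph ↔
      ∃ w : H, (b : H →L[ℂ] H) w = x ∧ (a : H →L[ℂ] H) w = y := by
  simp only [Represents, pair_mem_ranM_col]

theorem represents_quotient {a b : M.toStarSubalgebra}
    (h : LinearMap.ker ((b : H →L[ℂ] H) : H →ₗ[ℂ] H) ≤
      LinearMap.ker ((a : H →L[ℂ] H) : H →ₗ[ℂ] H)) :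
    Represents (col b a) (quotient (a : H →L[ℂ] H) (b : H →L[ℂ] H)) := by
  rw [represents_col_iff]
  intro x y
  rw [graph_quotient h]
  constructor
  · rintro ⟨w, hw⟩
    exact ⟨w, congrArg Prod.fst hw, congrArg Prod.snd hw⟩
  · rintro ⟨w, rfl, rfl⟩
    exact ⟨w, rfl⟩

theorem ker_le_of_represents_col {a b : M.toStarSubalgebra} {T : H →ₗ.[ℂ] H}
    (h : Represents (col b a) T) :
    LinearMap.ker ((b : H →L[ℂ] H) : H →ₗ[ℂ] H) ≤
      LinearMap.ker ((a : H →L[ℂ] H) : H →ₗ[ℂ] H) := by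
  intro x hx
  exact LinearPMap.graph_fst_eq_zero_snd T ((represents_col_iff.1 h _ _).2 ⟨x, rfl, rfl⟩) hx

namespace Represents

variable {C : Matrix (Fin 2) ι M.toStarSubalgebra} {D : Matrix (Fin 2) κ M.toStarSubalgebra}
  {S T : H →ₗ.[ℂ] H}

theorem unique (hS : Represents C S) (hT : Represents C T) : S = T := by
  apply LinearPMap.eq_of_eq_graph
  ext ⟨x, y⟩
  rw [hS, hT]

theorem ranM_eq (hC : Represents C T) (hD : Represents D T) : ranM C = ranM D := by
  ext v
  rw [eq_pair v, ← hC, ← hD]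

theorem congr (hC : Represents C T) (h : ranM C = ranM D) : Represents D T := by
  intro x y
  rw [← h]
  exact hC x y

end Represents

/-- The matrix of the projection onto the closure of the range. -/
def closeM [DecidableEq κ] (C : Matrix κ ι M.toStarSubalgebra) : Matrix κ κ M.toStarSubalgebra :=
  1 - kerProj C.conjTranspose

/-- The closure of a range is the orthogonal complement of the kernel of the adjoint. -/
theorem opM_closeM [DecidableEq κ] (C : Matrix κ ι M.toStarSubalgebra) :
    opM (closeM C) = (ranM C).topologicalClosure.starProjection := by
  have h1 : (ranM C).topologicalClosure = (kerM C.conjTranspose)ᗮ := by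
    have := (ContinuousLinearMap.adjoint (opM C)).orthogonal_ker
    rw [ContinuousLinearMap.adjoint_adjoint] at this
    rw [← this, kerM, opM_conjTranspose]
  have h2 : (kerM C.conjTranspose)ᗮ.starProjection =
      (ranM C).topologicalClosure.starProjection := by
    congr 1
    exact h1.symm
  rw [← h2, closeM, opM_sub, opM_one, opM_kerProj, Submodule.starProjection_orthogonal]

theorem mem_ranM_closeM [DecidableEq κ] {C : Matrix κ ι M.toStarSubalgebra} {y : Amp H κ} :
    y ∈ ranM (closeM C) ↔ y ∈ closure (ranM C : Set (Amp H κ)) := by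
  change _ ↔ y ∈ (ranM C).topologicalClosure
  rw [mem_ranM, opM_closeM]
  constructor
  · rintro ⟨x, rfl⟩
    exact Submodule.starProjection_apply_mem _ _
  · intro hy
    exact ⟨y, Submodule.starProjection_eq_self_iff.2 hy⟩

theorem Represents.mem_closure_graph {C : Matrix (Fin 2) ι M.toStarSubalgebra} {T : H →ₗ.[ℂ] H}
    (h : Represents C T) (x y : H) :
    (x, y) ∈ T.graph.topologicalClosure ↔ pair x y ∈ ranM (closeM C) := by
  rw [mem_ranM_closeM]
  constructor
  · intro hxy
    exact map_mem_closure continuous_pair (s := (T.graph : Set (H × H))) hxy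
      fun p hp => (h p.1 p.2).1 hp
  · intro hxy
    have hmaps : Set.MapsTo (fun v : Amp H (Fin 2) => (v 0, v 1)) (ranM C : Set (Amp H (Fin 2)))
        (T.graph : Set (H × H)) := fun p hp => by
      rw [SetLike.mem_coe, h, ← eq_pair]
      exact hp
    have := map_mem_closure continuous_coords hxy hmaps
    exact this

theorem Represents.closure {C : Matrix (Fin 2) ι M.toStarSubalgebra} {T : H →ₗ.[ℂ] H}
    (h : Represents C T) (hT : T.IsClosable) : Represents (closeM C) T.closure := by
  intro x y
  rw [← hT.graph_closure_eq_closure_graph, h.mem_closure_graph]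

/-- The first row of the identity matrix of size two. -/
def firstRow (M : VonNeumannAlgebra H) : Matrix (Fin 1) (Fin 2) M.toStarSubalgebra := !![1, 0]

theorem opM_firstRow_apply (v : Amp H (Fin 2)) : opM (firstRow M) v 0 = v 0 := by
  rw [opM_apply]
  simp [firstRow]

/-- Closability means that the closed graph contains no `(0, y)` with `y ≠ 0`. As that closure is
the range of `closeM C`, vanishing of the first coordinate must force the whole vector to vanish. In
this form `kerM_map_le` applies. -/
theorem Represents.isClosable_iff {C : Matrix (Fin 2) ι M.toStarSubalgebra} {T : H →ₗ.[ℂ] H}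
    (h : Represents C T) :
    T.IsClosable ↔ kerM (firstRow M * closeM C) ≤ kerM (closeM C) := by
  have hrow : ∀ v, opM (firstRow M * closeM C) v = 0 ↔ opM (closeM C) v 0 = 0 := by
    intro v
    rw [opM_mul_apply]
    constructor
    · intro hv
      rw [← opM_firstRow_apply (M := M), hv]
      rfl
    · intro hv
      ext i
      fin_cases i
      exact (opM_firstRow_apply _).trans hv
  constructor
  · intro hT v hv
    rw [mem_kerM, hrow] at hv
    have h1 : ((opM (closeM C) v) 0, (opM (closeM C) v) 1) ∈ T.closure.graph := by
      rw [h.closure hT, ← eq_pair]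
      exact ⟨v, rfl⟩
    have h2 := LinearPMap.graph_fst_eq_zero_snd _ h1 hv
    rw [mem_kerM, eq_pair (opM (closeM C) v), hv, h2]
    exact (eq_pair (0 : Amp H (Fin 2))).symm
  · intro hk
    refine ⟨T.graph.topologicalClosure.toLinearPMap, (Submodule.toLinearPMap_graph_eq _ ?_).symm⟩
    rintro ⟨x, y⟩ hxy hx
    have hx : x = 0 := hx
    subst hx
    rw [h.mem_closure_graph] at hxy
    obtain ⟨v, hv⟩ := hxy
    have hv : opM (closeM C) v = pair 0 y := hv
    have h3 : v ∈ kerM (closeM C) := hk (by rw [mem_kerM, hrow, hv, pair_zero])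
    rw [mem_kerM, hv] at h3
    exact congrArg (fun w : Amp H (Fin 2) => w 1) h3

/-- Closedness becomes an equality of ranges, which `ranM_map_eq` transports. -/
theorem Represents.isClosed_iff {C : Matrix (Fin 2) ι M.toStarSubalgebra} {T : H →ₗ.[ℂ] H}
    (h : Represents C T) : T.IsClosed ↔ ranM (closeM C) = ranM C := by
  constructor
  · intro hT
    ext v
    have e : _root_.closure (T.graph : Set (H × H)) = T.graph := IsClosed.closure_eq hT
    rw [eq_pair v, ← h.mem_closure_graph, ← h, ← SetLike.mem_coe,
      Submodule.topologicalClosure_coe, e, SetLike.mem_coe]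
  · intro hC
    have e : T.graph.topologicalClosure = T.graph := by
      ext ⟨x, y⟩
      rw [h.mem_closure_graph, hC, ← h]
    change _root_.IsClosed (T.graph : Set (H × H))
    rw [← e]
    exact T.graph.isClosed_topologicalClosure

theorem pair_unitary_mem_ranM_iff (C : Matrix (Fin 2) ι M.toStarSubalgebra) {U : H →L[ℂ] H}
    (hUM : U ∈ M.commutant) (hU : U ∈ unitary (H →L[ℂ] H)) (x y : H) :
    pair (U x) (U y) ∈ ranM C ↔ pair x y ∈ ranM C := by
  have e : ∀ (V : H →L[ℂ] H) (x y : H), diag (Fin 2) V (pair x y) = pair (V x) (V y) := by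
    intro V x y
    rw [eq_pair_iff]
    simp
  have key : ∀ (V : H →L[ℂ] H) (x y : H), V ∈ M.commutant → pair x y ∈ ranM C →
      pair (V x) (V y) ∈ ranM C := by
    rintro V x y hV ⟨w, hw⟩
    refine ⟨diag ι V w, ?_⟩
    rw [← e, ← hw]
    exact opM_diag C hV w
  constructor
  · intro h
    have := key (star U) _ _ (star_mem hUM) h
    rwa [unitary_left hU, unitary_left hU] at this
  · exact key U x y hUM

theorem Represents.mem_mvnAff {C : Matrix (Fin 2) ι M.toStarSubalgebra} {T : H →ₗ.[ℂ] H}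
    (h : Represents C T) (hT : T.IsClosed) : T ∈ mvnAff M := by
  rw [mem_mvnAff_iff]
  refine ⟨hT, fun U hUM hU x y => ?_⟩
  rw [h, h, pair_unitary_mem_ranM_iff C hUM hU]

end VN

/-! ### Computing `Φ_aff` from any matrix of the graph -/

section Morphisms

variable {H : Type u} [NormedAddCommGroup H] [InnerProductSpace ℂ H] [CompleteSpace H]
  {K : Type v} [NormedAddCommGroup K] [InnerProductSpace ℂ K] [CompleteSpace K]
  {M : VonNeumannAlgebra H} {N : VonNeumannAlgebra K}
  {Φ : M.toStarSubalgebra →⋆ₐ[ℂ] N.toStarSubalgebra}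
variable {ι κ μ : Type} [Fintype ι] [Fintype κ] [Fintype μ]

theorem map_col (b a : M.toStarSubalgebra) : (col b a).map Φ = col (Φ b) (Φ a) := by
  refine Matrix.ext fun i j => ?_
  fin_cases i <;> fin_cases j <;> rfl

theorem map_firstRow : (firstRow M).map Φ = firstRow N := by
  refine Matrix.ext fun i j => ?_
  fin_cases i
  fin_cases j
  · exact map_one Φ
  · exact map_zero Φ

theorem mem_kerM_scalar {b : M.toStarSubalgebra} {x : Amp H (Fin 1)} :
    x ∈ kerM !![b] ↔ (b : H →L[ℂ] H) (x 0) = 0 := by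
  rw [mem_kerM]
  constructor
  · intro h
    have := congrArg (fun w : Amp H (Fin 1) => w 0) h
    simpa [opM_apply] using this
  · intro h
    ext i
    fin_cases i
    simp [opM_apply, h]

theorem kerM_scalar_le_iff {a b : M.toStarSubalgebra} :
    kerM !![b] ≤ kerM !![a] ↔ LinearMap.ker ((b : H →L[ℂ] H) : H →ₗ[ℂ] H) ≤
      LinearMap.ker ((a : H →L[ℂ] H) : H →ₗ[ℂ] H) := by
  constructor
  · intro h x hx
    have := @h (WithLp.toLp 2 ![x]) (mem_kerM_scalar.2 hx)
    exact mem_kerM_scalar.1 this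
  · intro h x hx
    rw [mem_kerM_scalar] at hx ⊢
    exact h hx

theorem map_scalar (b : M.toStarSubalgebra) : (!![b]).map Φ = !![Φ b] := by
  refine Matrix.ext fun i j => ?_
  fin_cases i
  fin_cases j
  rfl

theorem ker_map_le (hΦ : IsNormalHom Φ) {a b : M.toStarSubalgebra}
    (h : LinearMap.ker ((b : H →L[ℂ] H) : H →ₗ[ℂ] H) ≤
      LinearMap.ker ((a : H →L[ℂ] H) : H →ₗ[ℂ] H)) :
    LinearMap.ker ((Φ b : K →L[ℂ] K) : K →ₗ[ℂ] K) ≤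
      LinearMap.ker ((Φ a : K →L[ℂ] K) : K →ₗ[ℂ] K) := by
  rw [← kerM_scalar_le_iff, ← map_scalar, ← map_scalar]
  exact kerM_map_le hΦ (kerM_scalar_le_iff.2 h)

theorem map_closeM (hΦ : IsNormalHom Φ) [DecidableEq κ] (C : Matrix κ ι M.toStarSubalgebra) :
    (closeM C).map Φ = closeM (C.map Φ) := by
  rw [closeM, closeM, map_subM, map_oneM, map_kerProj hΦ, map_conjTransposeM]

/-- Matrices with equal ranges keep equal ranges under `Φ`, so neither the chosen quotient nor the
number of columns matters. This gives well-definedness and allows the two-column matrices of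
products, sums and adjoints. -/
theorem represents_phiAff (hΦ : IsNormalHom Φ) {C : Matrix (Fin 2) ι M.toStarSubalgebra}
    {T : H →ₗ.[ℂ] H} (hT : T ∈ aff M) (h : Represents C T) :
    Represents (C.map Φ) (phiAff Φ ⟨T, hT⟩) := by
  have hs := hT.choose_spec.choose_spec
  have h1 : Represents (col hT.choose_spec.choose hT.choose) T := by
    have := represents_quotient hs.1
    rwa [← hs.2] at this
  have h2 : Represents (col (Φ hT.choose_spec.choose) (Φ hT.choose)) (phiAff Φ ⟨T, hT⟩) :=
    represents_quotient (ker_map_le hΦ hs.1)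
  rw [← map_col] at h2
  exact h2.congr (ranM_map_eq Φ (h1.ranM_eq h))

theorem phiAff_quotient (hΦ : IsNormalHom Φ) {a b : M.toStarSubalgebra}
    (h : LinearMap.ker ((b : H →L[ℂ] H) : H →ₗ[ℂ] H) ≤
      LinearMap.ker ((a : H →L[ℂ] H) : H →ₗ[ℂ] H))
    (hq : quotient (a : H →L[ℂ] H) (b : H →L[ℂ] H) ∈ aff M) :
    phiAff Φ ⟨quotient (a : H →L[ℂ] H) (b : H →L[ℂ] H), hq⟩ =
      quotient (Φ a : K →L[ℂ] K) (Φ b : K →L[ℂ] K) := by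
  have h1 := represents_phiAff hΦ hq (represents_quotient h)
  rw [map_col] at h1
  exact h1.unique (represents_quotient (ker_map_le hΦ h))

theorem Represents.isClosed_map (hΦ : IsNormalHom Φ) {C : Matrix (Fin 2) ι M.toStarSubalgebra}
    {T : H →ₗ.[ℂ] H} {T' : K →ₗ.[ℂ] K} (h : Represents C T) (h' : Represents (C.map Φ) T')
    (hT : T.IsClosed) : T'.IsClosed := by
  rw [h'.isClosed_iff, ← map_closeM hΦ]
  exact ranM_map_eq Φ (h.isClosed_iff.1 hT)

theorem Represents.isClosable_map (hΦ : IsNormalHom Φ) {C : Matrix (Fin 2) ι M.toStarSubalgebra}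
    {T : H →ₗ.[ℂ] H} {T' : K →ₗ.[ℂ] K} (h : Represents C T) (h' : Represents (C.map Φ) T')
    (hT : T.IsClosable) : T'.IsClosable := by
  rw [h'.isClosable_iff, ← map_closeM hΦ, ← map_firstRow (Φ := Φ), ← map_mulM]
  exact kerM_map_le hΦ (h.isClosable_iff.1 hT)

theorem phiAff_closure (hΦ : IsNormalHom Φ) {C : Matrix (Fin 2) ι M.toStarSubalgebra}
    {T : H →ₗ.[ℂ] H} {T' : K →ₗ.[ℂ] K} (h : Represents C T) (h' : Represents (C.map Φ) T')
    (hT : T.IsClosable) (hcl : T.closure ∈ aff M) :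
    phiAff Φ ⟨T.closure, hcl⟩ = T'.closure := by
  have h1 := represents_phiAff hΦ hcl (h.closure hT)
  rw [map_closeM hΦ] at h1
  exact h1.unique (h'.closure (h.isClosable_map hΦ h' hT))

end Morphisms

/-! ### Square roots and polar decomposition -/

section Polar

variable {E F : Type*} [NormedAddCommGroup E] [InnerProductSpace ℂ E] [CompleteSpace E]
  [NormedAddCommGroup F] [InnerProductSpace ℂ F] [CompleteSpace F]

/-- A positive operator has a self-adjoint square root, which commutes with everything that
commutes with the operator. -/
theorem exists_sqrt {A : E →L[ℂ] E} (hA : A.IsPositive) :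
    ∃ B : E →L[ℂ] E, IsSelfAdjoint B ∧ (∀ x, B (B x) = A x) ∧
      ∀ S : E →L[ℂ] E, (∀ x, A (S x) = S (A x)) → ∀ x, B (S x) = S (B x) := by
  have hpos : 0 ≤ A := (ContinuousLinearMap.nonneg_iff_isPositive _).2 hA
  refine ⟨CFC.sqrt A, IsSelfAdjoint.of_nonneg (CFC.sqrt_nonneg A),
    fun x => congrArg (fun f : E →L[ℂ] E => f x) (CFC.sqrt_mul_sqrt_self A hpos),
    fun S hS x => ?_⟩
  have hc : Commute A S := ContinuousLinearMap.ext hS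
  exact congrArg (fun f : E →L[ℂ] E => f x) (hc.cfcₙ_nnreal NNReal.sqrt).eq

/-- The polar decomposition of a bounded operator, relative to a square root `B` of `J* J`. -/
theorem exists_polar (J : E →L[ℂ] F) (B : E →L[ℂ] E) (hB : IsSelfAdjoint B)
    (hBJ : ∀ x, ‖J x‖ = ‖B x‖) :
    ∃ V : E →L[ℂ] F, (∀ x, V (B x) = J x) ∧ (∀ x, B x = 0 → V x = 0) ∧
      LinearMap.range (V : E →ₗ[ℂ] F) = (LinearMap.range (J : E →ₗ[ℂ] F)).topologicalClosure := by
  let L : Submodule ℂ E := (LinearMap.range (B : E →ₗ[ℂ] E)).topologicalClosure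
  have hL : L = (LinearMap.ker (B : E →ₗ[ℂ] E))ᗮ := by
    rw [ContinuousLinearMap.orthogonal_ker, hB.adjoint_eq]
  have : CompleteSpace L :=
    (LinearMap.range (B : E →ₗ[ℂ] E)).isClosed_topologicalClosure.completeSpace_coe
  let e : E →ₗ[ℂ] L := (B : E →ₗ[ℂ] E).codRestrict L fun x =>
    Submodule.le_topologicalClosure _ ⟨x, rfl⟩
  have he : DenseRange e := by
    intro y
    have hy : (y : E) ∈ closure (LinearMap.range (B : E →ₗ[ℂ] E) : Set E) := y.2
    rw [Metric.mem_closure_iff] at hy ⊢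
    intro ε hε
    obtain ⟨_, ⟨x, rfl⟩, hx⟩ := hy ε hε
    exact ⟨e x, ⟨x, rfl⟩, hx⟩
  have hne : ∀ x, ‖(J : E →ₗ[ℂ] F) x‖ ≤ 1 * ‖e x‖ := fun x => by
    rw [one_mul]
    exact (hBJ x).le
  -- `B x ↦ J x` is isometric on the range of `B`; it extends to the closure `L`, and its range is
  -- closed because `L` is complete.
  let g : L →L[ℂ] F := (J : E →ₗ[ℂ] F).extendOfNorm e
  have hg : ∀ x, g (e x) = J x := LinearMap.extendOfNorm_eq he ⟨1, hne⟩
  have hgn : ∀ y, ‖g y‖ = ‖y‖ := fun y => by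
    refine he.induction_on (p := fun y => ‖g y‖ = ‖y‖) y
      (isClosed_eq (by fun_prop) (by fun_prop)) fun x => ?_
    rw [hg]
    exact hBJ x
  have hgc : _root_.IsClosed (Set.range g) := by
    have : Isometry g := AddMonoidHomClass.isometry_of_norm g hgn
    exact this.isClosedEmbedding.isClosed_range
  refine ⟨g ∘L L.orthogonalProjectionOnto, fun x => ?_, fun x hx => ?_, ?_⟩
  · rw [ContinuousLinearMap.comp_apply, ← hg]
    congr 1
    exact Submodule.orthogonalProjectionOnto_mem_subspace_eq_self (e x)
  · rw [ContinuousLinearMap.comp_apply,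
      Submodule.orthogonalProjectionOnto_apply_of_mem_orthogonal, map_zero]
    rw [hL]
    exact Submodule.le_orthogonal_orthogonal _ hx
  · apply le_antisymm
    · rintro _ ⟨x, rfl⟩
      refine he.induction_on
        (p := fun y => g y ∈ (LinearMap.range (J : E →ₗ[ℂ] F)).topologicalClosure)
        (L.orthogonalProjectionOnto x) ?_ fun z => ?_
      · exact (Submodule.isClosed_topologicalClosure _).preimage g.continuous
      · rw [hg]
        exact Submodule.le_topologicalClosure _ ⟨z, rfl⟩
    · refine Submodule.topologicalClosure_minimal _ ?_ ?_
      · rintro _ ⟨x, rfl⟩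
        refine ⟨B x, ?_⟩
        change g (L.orthogonalProjectionOnto (B x)) = J x
        rw [← hg]
        congr 1
        exact Submodule.orthogonalProjectionOnto_mem_subspace_eq_self (e x)
      · have : (LinearMap.range ((g ∘L L.orthogonalProjectionOnto : E →L[ℂ] F) : E →ₗ[ℂ] F) : Set F)
            = Set.range g := by
          ext y
          constructor
          · rintro ⟨x, rfl⟩
            exact ⟨_, rfl⟩
          · rintro ⟨x, rfl⟩
            exact ⟨x, congrArg g (Submodule.orthogonalProjectionOnto_mem_subspace_eq_self x)⟩
        rw [this]
        exact hgc

/-- An operator intertwining `B` and `J` intertwines the polar part. -/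
theorem polar_intertwine {J V : E →L[ℂ] F} {B : E →L[ℂ] E} (hB : IsSelfAdjoint B)
    (hV : ∀ x, V (B x) = J x) (hV' : ∀ x, B x = 0 → V x = 0) {S : E →L[ℂ] E} {S' : F →L[ℂ] F}
    (hBS : ∀ x, B (S x) = S (B x)) (hJS : ∀ x, J (S x) = S' (J x)) (x : E) :
    V (S x) = S' (V x) := by
  set k := LinearMap.ker (B : E →ₗ[ℂ] E)
  -- `S` preserves the kernel of `B`, where `V` vanishes. On the complement, the identity is checked
  -- on the dense range of `B` and extended by continuity.
  have h1 : ∀ y ∈ k, V (S y) = S' (V y) := by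
    intro y hy
    have hy : B y = 0 := hy
    rw [hV' y hy, map_zero]
    exact hV' _ (by rw [hBS, hy, map_zero])
  have h2 : ∀ y ∈ kᗮ, V (S y) = S' (V y) := by
    intro y hy
    have hk : kᗮ = (LinearMap.range (B : E →ₗ[ℂ] E)).topologicalClosure := by
      rw [ContinuousLinearMap.orthogonal_ker, hB.adjoint_eq]
    rw [hk] at hy
    have hcl : _root_.IsClosed {y | V (S y) = S' (V y)} := isClosed_eq (by fun_prop) (by fun_prop)
    refine closure_minimal ?_ hcl hy
    rintro _ ⟨z, rfl⟩
    change V (S (B z)) = S' (V (B z))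
    rw [← hBS, hV, hV, hJS]
  have h3 := h1 _ (Submodule.starProjection_apply_mem k x)
  have h4 := h2 _ (Submodule.sub_starProjection_mem_orthogonal (K := k) x)
  rw [map_sub, map_sub, map_sub, map_sub, h3] at h4
  exact sub_left_injective h4

end Polar

/-! ### Murray-von Neumann affiliated operators are quotients -/

section VN

variable {H : Type u} [NormedAddCommGroup H] [InnerProductSpace ℂ H] [CompleteSpace H]
variable {M : VonNeumannAlgebra H}
variable {ι κ μ : Type} [Fintype ι] [Fintype κ] [Fintype μ]

theorem isClosed_coe (M : VonNeumannAlgebra H) :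
    _root_.IsClosed (M.toStarSubalgebra : Set (H →L[ℂ] H)) := by
  have : (M.toStarSubalgebra : Set (H →L[ℂ] H)) =
      Set.centralizer (Set.centralizer (M : Set (H →L[ℂ] H))) := M.centralizer_centralizer.symm
  rw [this]
  exact Set.isClosed_centralizer _

theorem mem_span_unitary {S : H →L[ℂ] H} (hS : S ∈ M) :
    S ∈ Submodule.span ℂ {U | U ∈ M ∧ U ∈ unitary (H →L[ℂ] H)} := by
  -- Norm-closedness makes `M` a C*-algebra, and a C*-algebra is spanned by its unitaries.
  have := isClosed_coe M
  have h : (⟨S, hS⟩ : M.toStarSubalgebra) ∈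
      Submodule.span ℂ (unitary M.toStarSubalgebra : Set M.toStarSubalgebra) := by
    rw [CStarAlgebra.span_unitary]
    trivial
  have h2 := Submodule.apply_mem_span_image_of_mem_span
    (M.toStarSubalgebra.subtype.toAlgHom.toLinearMap) h
  refine Submodule.span_mono ?_ h2
  rintro _ ⟨U, hU, rfl⟩
  refine ⟨U.2, ?_⟩
  have hU := Unitary.mem_iff.1 hU
  exact Unitary.mem_iff.2 ⟨congrArg Subtype.val hU.1, congrArg Subtype.val hU.2⟩

/-- The definition tests only unitaries, but these span the commutant and the graph is a linear
subspace. -/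
theorem graph_invariant {T : H →ₗ.[ℂ] H} (hT : T ∈ mvnAff M) {S : H →L[ℂ] H}
    (hS : S ∈ M.commutant) {x y : H} (hxy : (x, y) ∈ T.graph) : (S x, S y) ∈ T.graph := by
  rw [mem_mvnAff_iff] at hT
  refine Submodule.span_induction (p := fun S _ => (S x, S y) ∈ T.graph) ?_ ?_ ?_ ?_
    (mem_span_unitary hS)
  · rintro U ⟨h1, h2⟩
    exact (hT.2 U h1 h2 x y).2 hxy
  · exact T.graph.zero_mem
  · intro A B _ _ hA hB
    exact T.graph.add_mem hA hB
  · intro c A _ hA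
    exact T.graph.smul_mem c hA

/-- The graph of `T`, as a subspace of the Hilbert sum of two copies of `H`. -/
def ampGraph (T : H →ₗ.[ℂ] H) : Submodule ℂ (Amp H (Fin 2)) where
  carrier := {v | (v 0, v 1) ∈ T.graph}
  zero_mem' := T.graph.zero_mem
  add_mem' := fun ha hb => T.graph.add_mem ha hb
  smul_mem' := fun c _ ha => T.graph.smul_mem c ha

/-- The closure of the range of a matrix is the range of a matrix of the same format. -/
theorem exists_ranM_eq_topologicalClosure (J : Matrix κ ι M.toStarSubalgebra) :
    ∃ C : Matrix κ ι M.toStarSubalgebra, ranM C = (ranM J).topologicalClosure := by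
  -- `B` is the modulus `|J|`; it commutes with the diagonal commutant because `Jᴴ J` does. The
  -- polar part then intertwines the diagonal actions, so it is a matrix over `M`, and its range is
  -- closed.
  obtain ⟨B, hB, hBB, hBS⟩ : ∃ B : Amp H ι →L[ℂ] Amp H ι, IsSelfAdjoint B ∧
      (∀ x, B (B x) = opM (J.conjTranspose * J) x) ∧
      ∀ S ∈ M.commutant, ∀ x, B (diag ι S x) = diag ι S (B x) := by
    obtain ⟨B, h1, h2, h3⟩ := exists_sqrt (isPositive_opM_gram J)
    exact ⟨B, h1, h2, fun S hS => h3 _ fun x => opM_diag _ hS x⟩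
  have hBJ : ∀ x, ‖opM J x‖ = ‖B x‖ := by
    intro x
    have h1 : inner ℂ (opM J x) (opM J x) = inner ℂ (B x) (B x) := by
      rw [← ContinuousLinearMap.adjoint_inner_left, ← opM_conjTranspose, ← opM_mul_apply, ← hBB]
      conv_lhs => rw [← hB.adjoint_eq, ContinuousLinearMap.adjoint_inner_left]
      rw [hB.adjoint_eq]
    rw [inner_self_eq_norm_sq_to_K, inner_self_eq_norm_sq_to_K] at h1
    have h2 : ‖opM J x‖ ^ 2 = ‖B x‖ ^ 2 := by exact_mod_cast h1
    exact (sq_eq_sq₀ (norm_nonneg _) (norm_nonneg _)).1 h2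
  obtain ⟨V, hV, hV', hVr⟩ := exists_polar (opM J) B hB hBJ
  obtain ⟨C, hC⟩ := exists_opM_eq (M := M) V fun S hS =>
    polar_intertwine hB hV hV' (hBS S hS) (fun x => opM_diag J hS x)
  refine ⟨C, ?_⟩
  rw [← hVr, ranM, hC]

theorem exists_col_represents {T : H →ₗ.[ℂ] H} (hT : T ∈ mvnAff M) :
    ∃ b a : M.toStarSubalgebra, Represents (col b a) T := by
  have hcl : _root_.IsClosed (ampGraph T : Set (Amp H (Fin 2))) :=
    IsClosed.preimage continuous_coords hT.1
  have : CompleteSpace (ampGraph T) := hcl.completeSpace_coe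
  -- `J` is the first column of the projection onto the graph; a single column is what a quotient
  -- requires.
  obtain ⟨J, hJ⟩ : ∃ J : Matrix (Fin 2) (Fin 1) M.toStarSubalgebra,
      ∀ x, opM J x = (ampGraph T).starProjection (pair (x 0) 0) := by
    obtain ⟨P, hP⟩ := exists_opM_eq_starProjection (M := M) (ampGraph T) fun S hS v hv => by
      change ((diag (Fin 2) S v) 0, (diag (Fin 2) S v) 1) ∈ T.graph
      rw [diag_apply, diag_apply]
      exact graph_invariant hT hS hv
    refine ⟨_, fun x => (opM_mul_apply P (col 1 0) x).trans ?_⟩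
    have hcol : opM (col (M := M) 1 0) x = pair (x 0) 0 := by
      rw [eq_pair_iff]
      simp [opM_apply, col]
    rw [hcol, hP]
  obtain ⟨C, hC⟩ := exists_ranM_eq_topologicalClosure J
  have hCcol : C = col (C 0 0) (C 1 0) := by
    refine Matrix.ext fun i j => ?_
    fin_cases i <;> fin_cases j <;> rfl
  refine ⟨C 0 0, C 1 0, ?_⟩
  rw [← hCcol]
  have hle : (ranM J).topologicalClosure ≤ ampGraph T := by
    refine Submodule.topologicalClosure_minimal _ ?_ hcl
    rintro _ ⟨x, rfl⟩
    change opM J x ∈ _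
    rw [hJ]
    exact Submodule.starProjection_apply_mem _ _
  have hran : ranM C = ampGraph T := by
    rw [hC]
    refine le_antisymm hle fun w hw => ?_
    set R := (ranM J).topologicalClosure with hR
    have : CompleteSpace R := (Submodule.isClosed_topologicalClosure _).completeSpace_coe
    set z := w - R.starProjection w with hz
    have hzW : z ∈ ampGraph T :=
      Submodule.sub_mem _ hw (hle (Submodule.starProjection_apply_mem _ _))
    have hzR : z ∈ Rᗮ := Submodule.sub_starProjection_mem_orthogonal w
    -- `z` lies in the graph, so its inner product with the projection of `(z 0, 0)` is `⟪z 0, z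
    -- 0⟫`. Orthogonality to the range of `J` makes this vanish, and in a graph a zero first
    -- coordinate forces `z = 0`.
    have hz0 : z 0 = 0 := by
      have h2 : inner ℂ (opM J (WithLp.toLp 2 ![z 0])) z = 0 :=
        Submodule.inner_right_of_mem_orthogonal
          (Submodule.le_topologicalClosure _ (mem_ranM.2 ⟨_, rfl⟩)) hzR
      rw [hJ, Submodule.inner_starProjection_left_eq_right,
        Submodule.starProjection_eq_self_iff.2 hzW, PiLp.inner_apply, Fin.sum_univ_two] at h2
      simpa using h2
    have hz1 : z 1 = 0 := LinearPMap.graph_fst_eq_zero_snd T hzW hz0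
    have hzz : z = 0 := by
      rw [eq_pair z, hz0, hz1]
      exact (eq_pair (0 : Amp H (Fin 2))).symm
    rw [← sub_add_cancel w (R.starProjection w), ← hz, hzz, zero_add]
    exact Submodule.starProjection_apply_mem _ _
  intro x y
  rw [hran]
  rfl

theorem mvnAff_subset_aff (M : VonNeumannAlgebra H) : mvnAff M ⊆ aff M := by
  intro T hT
  obtain ⟨b, a, h⟩ := exists_col_represents hT
  have hk := ker_le_of_represents_col h
  exact ⟨a, b, hk, h.unique (represents_quotient hk)⟩

end VN

/-! ### Matrices for products, sums and adjoints -/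

section VN

variable {H : Type u} [NormedAddCommGroup H] [InnerProductSpace ℂ H] [CompleteSpace H]
variable {M : VonNeumannAlgebra H}
variable {ι κ μ : Type} [Fintype ι] [Fintype κ] [Fintype μ]

/-- The projection onto the kernel of an element of a von Neumann algebra. -/
def kp (b : M.toStarSubalgebra) : M.toStarSubalgebra := kerProj !![b] 0 0

theorem kerProj_scalar (b : M.toStarSubalgebra) : kerProj !![b] = !![kp b] := by
  refine Matrix.ext fun i j => ?_
  fin_cases i
  fin_cases j
  rfl

theorem opM_scalar_apply (b : M.toStarSubalgebra) (x : Amp H (Fin 1)) :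
    opM !![b] x 0 = (b : H →L[ℂ] H) (x 0) := by
  rw [opM_apply]
  simp

theorem apply_kp (b : M.toStarSubalgebra) (x : H) :
    (b : H →L[ℂ] H) ((kp b : H →L[ℂ] H) x) = 0 := by
  have h : opM (kerProj !![b]) (WithLp.toLp 2 ![x]) ∈ kerM !![b] := by
    rw [← ranM_kerProj]
    exact ⟨_, rfl⟩
  rw [mem_kerM_scalar, kerProj_scalar, opM_scalar_apply] at h
  exact h

theorem kp_apply_of_eq_zero {b : M.toStarSubalgebra} {x : H} (h : (b : H →L[ℂ] H) x = 0) :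
    (kp b : H →L[ℂ] H) x = x := by
  have h1 : opM (kerProj !![b]) (WithLp.toLp 2 ![x]) = WithLp.toLp 2 ![x] := by
    rw [opM_kerProj]
    exact Submodule.starProjection_eq_self_iff.2 (mem_kerM_scalar.2 h)
  have h2 := congrArg (fun w : Amp H (Fin 1) => w 0) h1
  simp only [kerProj_scalar, opM_scalar_apply] at h2
  exact h2

theorem star_kp (b : M.toStarSubalgebra) : star (kp b) = kp b := by
  have := congrFun (congrFun (kerProj_conjTranspose !![b]) 0) 0
  rwa [Matrix.conjTranspose_apply] at this

theorem coe_star_inner (b : M.toStarSubalgebra) (x y : H) :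
    inner ℂ (((star b : M.toStarSubalgebra) : H →L[ℂ] H) x) y =
      inner ℂ x ((b : H →L[ℂ] H) y) := by
  change inner ℂ ((star (b : H →L[ℂ] H)) x) y = _
  rw [ContinuousLinearMap.star_eq_adjoint, ContinuousLinearMap.adjoint_inner_left]

theorem kp_inner (b : M.toStarSubalgebra) (x y : H) :
    inner ℂ ((kp b : H →L[ℂ] H) x) y = inner ℂ x ((kp b : H →L[ℂ] H) y) := by
  rw [← coe_star_inner, star_kp]

theorem kp_star_apply (b : M.toStarSubalgebra) (x : H) :
    (kp (star b) : H →L[ℂ] H) ((b : H →L[ℂ] H) x) = 0 := by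
  refine ext_inner_left ℂ fun y => ?_
  rw [← kp_inner, ← coe_star_inner, apply_kp, inner_zero_left, inner_zero_right]

/-- The closed range of `b` is the complement of `ker b*`. The condition becomes an equation in `M`
that `Φ` can transport. -/
theorem mem_closure_range_iff (b : M.toStarSubalgebra) (z : H) :
    z ∈ (LinearMap.range ((b : H →L[ℂ] H) : H →ₗ[ℂ] H)).topologicalClosure ↔
      (kp (star b) : H →L[ℂ] H) z = 0 := by
  constructor
  · intro hz
    have hcl : _root_.IsClosed {z | (kp (star b) : H →L[ℂ] H) z = 0} :=
      isClosed_eq (by fun_prop) (by fun_prop)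
    refine closure_minimal ?_ hcl hz
    rintro _ ⟨x, rfl⟩
    exact kp_star_apply b x
  · intro hz
    have h := (ContinuousLinearMap.adjoint (b : H →L[ℂ] H)).orthogonal_ker
    rw [ContinuousLinearMap.adjoint_adjoint] at h
    rw [← h, Submodule.mem_orthogonal]
    intro y hy
    have hy : ((star b : M.toStarSubalgebra) : H →L[ℂ] H) y = 0 := hy
    rw [← kp_apply_of_eq_zero hy, kp_inner, hz, inner_zero_right]

theorem mem_ranM_mul_kerProj {Y : Matrix μ ι M.toStarSubalgebra}
    {X : Matrix κ ι M.toStarSubalgebra} {y : Amp H μ} :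
    y ∈ ranM (Y * kerProj X) ↔ ∃ w ∈ kerM X, opM Y w = y := by
  rw [mem_ranM]
  constructor
  · rintro ⟨x, rfl⟩
    refine ⟨opM (kerProj X) x, ?_, (opM_mul_apply _ _ _).symm⟩
    rw [← ranM_kerProj]
    exact ⟨x, rfl⟩
  · rintro ⟨w, hw, rfl⟩
    rw [← ranM_kerProj] at hw
    obtain ⟨x, rfl⟩ := hw
    exact ⟨x, opM_mul_apply _ _ _⟩

theorem opM_two_apply (p q r s : M.toStarSubalgebra) (x y : H) :
    opM !![p, q; r, s] (pair x y) = pair ((p : H →L[ℂ] H) x + (q : H →L[ℂ] H) y)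
      ((r : H →L[ℂ] H) x + (s : H →L[ℂ] H) y) := by
  rw [eq_pair_iff, opM_apply, opM_apply, Fin.sum_univ_two, Fin.sum_univ_two]
  exact ⟨rfl, rfl⟩

theorem pair_mem_kerM_row {p q : M.toStarSubalgebra} {x y : H} :
    pair x y ∈ kerM !![p, q] ↔ (p : H →L[ℂ] H) x + (q : H →L[ℂ] H) y = 0 := by
  have h : opM !![p, q] (pair x y) 0 = (p : H →L[ℂ] H) x + (q : H →L[ℂ] H) y := by
    rw [opM_apply, Fin.sum_univ_two]
    rfl
  rw [mem_kerM, ← h]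
  constructor
  · intro h
    rw [h]
    rfl
  · intro h
    ext i
    fin_cases i
    exact h

/-- A matrix whose range is the graph of the product of `a / b` and `a' / b'`. -/
def prodM (b a b' a' : M.toStarSubalgebra) : Matrix (Fin 2) (Fin 2) M.toStarSubalgebra :=
  (!![b', 0; 0, a] : Matrix (Fin 2) (Fin 2) M.toStarSubalgebra) *
    kerProj (!![a', -b] : Matrix (Fin 1) (Fin 2) M.toStarSubalgebra)

/-- A matrix whose range is the graph of the sum of `a / b` and `a' / b'`. -/
def sumM (b a b' a' : M.toStarSubalgebra) : Matrix (Fin 2) (Fin 2) M.toStarSubalgebra :=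
  (!![b, 0; a, a'] : Matrix (Fin 2) (Fin 2) M.toStarSubalgebra) *
    kerProj (!![b, -b'] : Matrix (Fin 1) (Fin 2) M.toStarSubalgebra)

/-- A matrix whose range is the graph of the adjoint of `a / b`. -/
def adjM (b a : M.toStarSubalgebra) : Matrix (Fin 2) (Fin 2) M.toStarSubalgebra :=
  kerProj !![star a, -star b; 0, kp (star b)]

/-- The product is defined at `b' u` when `a' u = b v` for some `v`, with value `a v`. Such pairs
`(u, v)` form the kernel of the row `(a', -b)`, and its projection turns the image of that kernel
into a range. -/
theorem pair_mem_ranM_prodM {b a b' a' : M.toStarSubalgebra} {x z : H} :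
    pair x z ∈ ranM (prodM b a b' a') ↔ ∃ u v, (a' : H →L[ℂ] H) u = (b : H →L[ℂ] H) v ∧
      (b' : H →L[ℂ] H) u = x ∧ (a : H →L[ℂ] H) v = z := by
  rw [prodM, mem_ranM_mul_kerProj]
  constructor
  · rintro ⟨w, hw, h⟩
    rw [eq_pair w] at hw h
    rw [opM_two_apply, eq_pair_iff] at h
    rw [pair_mem_kerM_row] at hw
    refine ⟨w 0, w 1, ?_, ?_, ?_⟩
    · simpa [← sub_eq_add_neg, sub_eq_zero] using hw
    · simpa using h.1
    · simpa using h.2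
  · rintro ⟨u, v, h, rfl, rfl⟩
    refine ⟨pair u v, ?_, ?_⟩
    · rw [pair_mem_kerM_row]
      simp [h]
    · rw [opM_two_apply, eq_pair_iff]
      simp

theorem pair_mem_ranM_sumM {b a b' a' : M.toStarSubalgebra} {x z : H} :
    pair x z ∈ ranM (sumM b a b' a') ↔ ∃ u v, (b : H →L[ℂ] H) u = (b' : H →L[ℂ] H) v ∧
      (b : H →L[ℂ] H) u = x ∧ (a : H →L[ℂ] H) u + (a' : H →L[ℂ] H) v = z := by
  rw [sumM, mem_ranM_mul_kerProj]
  constructor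
  · rintro ⟨w, hw, h⟩
    rw [eq_pair w] at hw h
    rw [opM_two_apply, eq_pair_iff] at h
    rw [pair_mem_kerM_row] at hw
    refine ⟨w 0, w 1, ?_, ?_, ?_⟩
    · simpa [← sub_eq_add_neg, sub_eq_zero] using hw
    · simpa using h.1
    · simpa using h.2
  · rintro ⟨u, v, h, rfl, rfl⟩
    refine ⟨pair u v, ?_, ?_⟩
    · rw [pair_mem_kerM_row]
      simp [h]
    · rw [opM_two_apply, eq_pair_iff]
      simp

/-- The first row encodes `⟪z, b w⟫ = ⟪y, a w⟫` for all `w`. The second places `z` in the closure of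
the domain, which fixes the adjoint when the domain is not dense. -/
theorem pair_mem_ranM_adjM {b a : M.toStarSubalgebra} {y z : H} :
    pair y z ∈ ranM (adjM b a) ↔
      (((star b : M.toStarSubalgebra) : H →L[ℂ] H) z =
        ((star a : M.toStarSubalgebra) : H →L[ℂ] H) y)
        ∧ (kp (star b) : H →L[ℂ] H) z = 0 := by
  rw [adjM, ranM_kerProj, mem_kerM, opM_two_apply, eq_comm, eq_pair_iff, PiLp.zero_apply,
    PiLp.zero_apply, eq_comm, eq_comm (a := (0 : H))]
  refine and_congr ?_ ?_
  · have : ((-star b : M.toStarSubalgebra) : H →L[ℂ] H) z =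
        -((star b : M.toStarSubalgebra) : H →L[ℂ] H) z := rfl
    rw [this, ← sub_eq_add_neg, sub_eq_zero, eq_comm]
  · have : ((0 : M.toStarSubalgebra) : H →L[ℂ] H) y = 0 := rfl
    rw [this, zero_add]

variable {b a b' a' : M.toStarSubalgebra} {S T : H →ₗ.[ℂ] H}

theorem Represents.opMul (hS : Represents (col b a) S) (hT : Represents (col b' a') T) :
    Represents (prodM b a b' a') (opMul S T) := by
  rw [represents_col_iff] at hS hT
  intro x z
  rw [mem_graph_opMul, pair_mem_ranM_prodM]
  constructor
  · rintro ⟨y, h1, h2⟩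
    obtain ⟨u, rfl, rfl⟩ := (hT _ _).1 h1
    obtain ⟨v, hv, rfl⟩ := (hS _ _).1 h2
    exact ⟨u, v, hv.symm, rfl, rfl⟩
  · rintro ⟨u, v, h, rfl, rfl⟩
    exact ⟨_, (hT _ _).2 ⟨u, rfl, rfl⟩, (hS _ _).2 ⟨v, h.symm, rfl⟩⟩

theorem Represents.add (hS : Represents (col b a) S) (hT : Represents (col b' a') T) :
    Represents (sumM b a b' a') (S + T) := by
  rw [represents_col_iff] at hS hT
  intro x z
  rw [mem_graph_add, pair_mem_ranM_sumM]
  constructor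
  · rintro ⟨y, y', h1, h2, rfl⟩
    obtain ⟨u, rfl, rfl⟩ := (hS _ _).1 h1
    obtain ⟨v, hv, rfl⟩ := (hT _ _).1 h2
    exact ⟨u, v, hv.symm, rfl, rfl⟩
  · rintro ⟨u, v, h, rfl, rfl⟩
    exact ⟨_, _, (hS _ _).2 ⟨u, rfl, rfl⟩, (hT _ _).2 ⟨v, h.symm, rfl⟩, rfl⟩

theorem Represents.domain_eq (hT : Represents (col b a) T) :
    T.domain = LinearMap.range ((b : H →L[ℂ] H) : H →ₗ[ℂ] H) := by
  rw [represents_col_iff] at hT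
  ext x
  rw [LinearPMap.mem_domain_iff]
  constructor
  · rintro ⟨y, hy⟩
    obtain ⟨w, rfl, -⟩ := (hT _ _).1 hy
    exact ⟨w, rfl⟩
  · rintro ⟨w, rfl⟩
    exact ⟨_, (hT _ _).2 ⟨w, rfl, rfl⟩⟩

theorem Represents.opAdjoint (hT : Represents (col b a) T) :
    Represents (adjM b a) (opAdjoint T) := by
  have hdom := hT.domain_eq
  rw [represents_col_iff] at hT
  intro y z
  rw [mem_graph_opAdjoint, pair_mem_ranM_adjM, hdom, mem_closure_range_iff, and_comm]
  refine and_congr_left fun _ => ?_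
  constructor
  · intro h
    refine ext_inner_right ℂ fun w => ?_
    rw [coe_star_inner, coe_star_inner]
    exact h _ _ ((hT _ _).2 ⟨w, rfl, rfl⟩)
  · intro h p q hpq
    obtain ⟨w, rfl, rfl⟩ := (hT _ _).1 hpq
    rw [← coe_star_inner, ← coe_star_inner, h]

theorem represents_ofBounded (A : M.toStarSubalgebra) :
    Represents (col 1 A) (ofBounded (A : H →L[ℂ] H)) := by
  rw [represents_col_iff]
  intro x y
  rw [mem_graph_ofBounded]
  constructor
  · intro h
    exact ⟨x, rfl, h⟩
  · rintro ⟨w, rfl, rfl⟩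
    rfl

theorem represents_trivialOp : Represents (col (0 : M.toStarSubalgebra) 0) (trivialOp H) := by
  rw [represents_col_iff]
  intro x y
  rw [mem_graph_trivialOp]
  constructor
  · rintro ⟨rfl, rfl⟩
    exact ⟨0, rfl, rfl⟩
  · rintro ⟨w, rfl, rfl⟩
    exact ⟨rfl, rfl⟩

end VN

/-! ### `Φ_aff` respects the operations -/

section Morphisms

variable {H : Type u} [NormedAddCommGroup H] [InnerProductSpace ℂ H] [CompleteSpace H]
  {K : Type v} [NormedAddCommGroup K] [InnerProductSpace ℂ K] [CompleteSpace K]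
  {M : VonNeumannAlgebra H} {N : VonNeumannAlgebra K}
  {Φ : M.toStarSubalgebra →⋆ₐ[ℂ] N.toStarSubalgebra}

theorem map_kp (hΦ : IsNormalHom Φ) (b : M.toStarSubalgebra) : Φ (kp b) = kp (Φ b) := by
  have h := congrFun (congrFun (map_kerProj hΦ !![b]) 0) 0
  rw [map_scalar] at h
  exact h

theorem map_two (p q r s : M.toStarSubalgebra) :
    (!![p, q; r, s]).map Φ = !![Φ p, Φ q; Φ r, Φ s] := by
  refine Matrix.ext fun i j => ?_
  fin_cases i <;> fin_cases j <;> rfl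

theorem map_row (p q : M.toStarSubalgebra) : (!![p, q]).map Φ = !![Φ p, Φ q] := by
  refine Matrix.ext fun i j => ?_
  fin_cases i
  fin_cases j <;> rfl

theorem map_prodM (hΦ : IsNormalHom Φ) (b a b' a' : M.toStarSubalgebra) :
    (prodM b a b' a').map Φ = prodM (Φ b) (Φ a) (Φ b') (Φ a') := by
  rw [prodM, prodM, map_mulM, map_kerProj hΦ, map_two, map_row, map_zero, map_neg]

theorem map_sumM (hΦ : IsNormalHom Φ) (b a b' a' : M.toStarSubalgebra) :
    (sumM b a b' a').map Φ = sumM (Φ b) (Φ a) (Φ b') (Φ a') := by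
  rw [sumM, sumM, map_mulM, map_kerProj hΦ, map_two, map_row, map_zero, map_neg]

theorem map_adjM (hΦ : IsNormalHom Φ) (b a : M.toStarSubalgebra) :
    (adjM b a).map Φ = adjM (Φ b) (Φ a) := by
  rw [adjM, adjM, map_kerProj hΦ, map_two, map_zero, map_neg, map_star, map_star, map_kp hΦ,
    map_star]

/-- The restriction of `Φ_aff` to the MvN-affiliated operators. -/
def phiMvN (Φ : M.toStarSubalgebra →⋆ₐ[ℂ] N.toStarSubalgebra) (hΦ : IsNormalHom Φ)
    (T : mvnAff M) : mvnAff N :=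
  ⟨phiAff Φ ⟨T, mvnAff_subset_aff M T.2⟩, by
    obtain ⟨b, a, h⟩ := exists_col_represents T.2
    have h' := represents_phiAff hΦ (mvnAff_subset_aff M T.2) h
    exact h'.mem_mvnAff (h.isClosed_map hΦ h' T.2.1)⟩

theorem represents_phiMvN_col (hΦ : IsNormalHom Φ) {T : mvnAff M} {b a : M.toStarSubalgebra}
    (h : Represents (col b a) (T : H →ₗ.[ℂ] H)) :
    Represents (col (Φ b) (Φ a)) (phiMvN Φ hΦ T : K →ₗ.[ℂ] K) := by
  have := represents_phiAff hΦ (mvnAff_subset_aff M T.2) h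
  rwa [map_col] at this

/-- The matrix of the product is built from the entries by operations commuting with `Φ`, and both
closability and closure are transported along a representing matrix. -/
theorem respectsStrongProd_phiMvN (hΦ : IsNormalHom Φ) : RespectsStrongProd (phiMvN Φ hΦ) := by
  intro S T hST
  obtain ⟨b, a, hS⟩ := exists_col_represents S.2
  obtain ⟨b', a', hT⟩ := exists_col_represents T.2
  have h1 := hS.opMul hT
  have h2 := (represents_phiMvN_col hΦ hS).opMul (represents_phiMvN_col hΦ hT)
  rw [← map_prodM hΦ] at h2
  exact ⟨h1.isClosable_map hΦ h2 hST, Subtype.ext (phiAff_closure hΦ h1 h2 hST _)⟩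

theorem respectsStrongSum_phiMvN (hΦ : IsNormalHom Φ) : RespectsStrongSum (phiMvN Φ hΦ) := by
  intro S T hST
  obtain ⟨b, a, hS⟩ := exists_col_represents S.2
  obtain ⟨b', a', hT⟩ := exists_col_represents T.2
  have h1 := hS.add hT
  have h2 := (represents_phiMvN_col hΦ hS).add (represents_phiMvN_col hΦ hT)
  rw [← map_sumM hΦ] at h2
  exact ⟨h1.isClosable_map hΦ h2 hST, Subtype.ext (phiAff_closure hΦ h1 h2 hST _)⟩

theorem isMvNExtension_phiMvN (hΦ : IsNormalHom Φ) : IsMvNExtension Φ (phiMvN Φ hΦ) where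
  ext A := by
    have h := represents_phiMvN_col hΦ (T := incl M A) (represents_ofBounded A)
    rw [map_one] at h
    exact Subtype.ext (h.unique (represents_ofBounded (Φ A)))
  strongProd := respectsStrongProd_phiMvN hΦ
  adjoint T := by
    obtain ⟨b, a, hT⟩ := exists_col_represents T.2
    have h1 := represents_phiAff hΦ (mvnAff_subset_aff M (adj T).2) hT.opAdjoint
    have h2 := (represents_phiMvN_col hΦ hT).opAdjoint
    rw [← map_adjM hΦ] at h2
    exact Subtype.ext (h1.unique h2)
  trivial := by
    have h := represents_phiMvN_col hΦ (T := triv M) represents_trivialOp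
    rw [map_zero] at h
    exact Subtype.ext (h.unique represents_trivialOp)

end Morphisms

/-! ### Strong-product identities that determine an extension -/

section VN

variable {H : Type u} [NormedAddCommGroup H] [InnerProductSpace ℂ H] [CompleteSpace H]
variable {M : VonNeumannAlgebra H}

/-- `V` is the strong-product of `S` and `T`. -/
def IsStrongProd (S T V : mvnAff M) : Prop :=
  (opMul (S : H →ₗ.[ℂ] H) T).graph.topologicalClosure = (V : H →ₗ.[ℂ] H).graph

/-- An equality of graphs already contains definedness: `V` witnesses closability. -/
theorem IsStrongProd.isClosable {S T V : mvnAff M} (h : IsStrongProd S T V) :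
    (opMul (S : H →ₗ.[ℂ] H) T).IsClosable := ⟨V, h⟩

theorem IsStrongProd.strongProd_eq {S T V : mvnAff M} (h : IsStrongProd S T V) :
    strongProd S T h.isClosable = V := by
  refine Subtype.ext (LinearPMap.eq_of_eq_graph ?_)
  exact h.isClosable.graph_closure_eq_closure_graph.symm.trans h

theorem isStrongProd_of_le {S T V : mvnAff M}
    (h1 : ∀ x y, (x, y) ∈ (opMul (S : H →ₗ.[ℂ] H) T).graph → (x, y) ∈ (V : H →ₗ.[ℂ] H).graph)
    (h2 : ∀ x y, (x, y) ∈ (V : H →ₗ.[ℂ] H).graph →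
      (x, y) ∈ (opMul (S : H →ₗ.[ℂ] H) T).graph.topologicalClosure) : IsStrongProd S T V :=
  le_antisymm (Submodule.topologicalClosure_minimal _ (fun p hp => h1 p.1 p.2 hp) V.2.1)
    fun p hp => h2 p.1 p.2 hp

theorem IsStrongProd.mem_graph {S T V : mvnAff M} (h : IsStrongProd S T V) {x y z : H}
    (hxy : (x, y) ∈ (T : H →ₗ.[ℂ] H).graph) (hyz : (y, z) ∈ (S : H →ₗ.[ℂ] H).graph) :
    (x, z) ∈ (V : H →ₗ.[ℂ] H).graph := by
  have h1 : (x, z) ∈ (opMul (S : H →ₗ.[ℂ] H) T).graph := (mem_graph_opMul _ _ _ _).2 ⟨y, hxy, hyz⟩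
  have h2 := Submodule.le_topologicalClosure _ h1
  rwa [h] at h2

theorem mem_graph_incl {A : M.toStarSubalgebra} {x y : H} :
    (x, y) ∈ (incl M A : H →ₗ.[ℂ] H).graph ↔ (A : H →L[ℂ] H) x = y := mem_graph_ofBounded _ _ _

theorem mem_graph_triv_mul {c : M.toStarSubalgebra} {x z : H} :
    (x, z) ∈ (opMul (triv M : H →ₗ.[ℂ] H) (incl M c)).graph ↔
      (c : H →L[ℂ] H) x = 0 ∧ z = 0 := by
  rw [mem_graph_opMul]
  constructor
  · rintro ⟨y, h1, h2⟩
    rw [mem_graph_incl] at h1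
    have h2 := (mem_graph_trivialOp _ _).1 h2
    exact ⟨h1.trans h2.1, h2.2⟩
  · rintro ⟨h, rfl⟩
    exact ⟨0, mem_graph_incl.2 h, (mem_graph_trivialOp _ _).2 ⟨rfl, rfl⟩⟩

theorem isClosed_triv_mul (c : M.toStarSubalgebra) :
    (opMul (triv M : H →ₗ.[ℂ] H) (incl M c)).IsClosed := by
  have e : ((opMul (triv M : H →ₗ.[ℂ] H) (incl M c)).graph : Set (H × H)) =
      {p | (c : H →L[ℂ] H) p.1 = 0} ∩ {p | p.2 = 0} := by
    ext ⟨x, z⟩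
    exact mem_graph_triv_mul
  change _root_.IsClosed _
  rw [e]
  exact (isClosed_eq (by fun_prop) (by fun_prop)).inter (isClosed_eq (by fun_prop) (by fun_prop))

/-- The restriction of the zero operator to the kernel of `c`. -/
def zeroOn (c : M.toStarSubalgebra) : mvnAff M :=
  ⟨opMul (triv M : H →ₗ.[ℂ] H) (incl M c),
    (represents_trivialOp.opMul (represents_ofBounded c)).mem_mvnAff (isClosed_triv_mul c)⟩

/-- This identity is how the prescribed value at the trivial operator enters: it forces the image of
the zero operator on any kernel. -/
theorem isStrongProd_zeroOn (c : M.toStarSubalgebra) :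
    IsStrongProd (triv M) (incl M c) (zeroOn c) :=
  isStrongProd_of_le (fun _ _ h => h) fun _ _ h => Submodule.le_topologicalClosure _ h

theorem coe_one_sub_apply (c : M.toStarSubalgebra) (x : H) :
    ((1 - c : M.toStarSubalgebra) : H →L[ℂ] H) x = x - (c : H →L[ℂ] H) x := rfl

theorem kp_kp (b : M.toStarSubalgebra) (x : H) :
    (kp b : H →L[ℂ] H) ((kp b : H →L[ℂ] H) x) = (kp b : H →L[ℂ] H) x :=
  kp_apply_of_eq_zero (apply_kp b x)

theorem isClosed_quotient_left (b : M.toStarSubalgebra) {S : H →ₗ.[ℂ] H}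
    (hS : Represents (col b (1 - kp b)) S) : S.IsClosed := by
  rw [represents_col_iff] at hS
  have e : (S.graph : Set (H × H)) =
      {p | (b : H →L[ℂ] H) p.2 = p.1} ∩ {p | (kp b : H →L[ℂ] H) p.2 = 0} := by
    ext ⟨x, y⟩
    rw [SetLike.mem_coe, hS]
    constructor
    · rintro ⟨w, rfl, rfl⟩
      simp only [coe_one_sub_apply]
      refine ⟨?_, ?_⟩
      · change (b : H →L[ℂ] H) _ = _
        rw [map_sub, apply_kp, sub_zero]
      · change (kp b : H →L[ℂ] H) _ = _
        rw [map_sub, kp_kp, sub_self]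
    · rintro ⟨h1, h2⟩
      have h1 : (b : H →L[ℂ] H) y = x := h1
      have h2 : (kp b : H →L[ℂ] H) y = 0 := h2
      exact ⟨y, h1, by rw [coe_one_sub_apply, h2, sub_zero]⟩
  change _root_.IsClosed _
  rw [e]
  exact (isClosed_eq (by fun_prop) (by fun_prop)).inter (isClosed_eq (by fun_prop) (by fun_prop))

theorem represents_leftInverse (b : M.toStarSubalgebra) :
    Represents (col b (1 - kp b))
      (quotient ((1 - kp b : M.toStarSubalgebra) : H →L[ℂ] H) (b : H →L[ℂ] H)) := by
  refine represents_quotient fun x hx => ?_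
  change ((1 - kp b : M.toStarSubalgebra) : H →L[ℂ] H) x = 0
  rw [coe_one_sub_apply, kp_apply_of_eq_zero hx, sub_self]

/-- The inverse of the restriction of `b` to the orthogonal complement of its kernel. -/
def leftInverse (b : M.toStarSubalgebra) : mvnAff M :=
  ⟨quotient ((1 - kp b : M.toStarSubalgebra) : H →L[ℂ] H) (b : H →L[ℂ] H),
    (represents_leftInverse b).mem_mvnAff (isClosed_quotient_left b (represents_leftInverse b))⟩

theorem mem_graph_leftInverse {b : M.toStarSubalgebra} {x y : H} :
    (x, y) ∈ (leftInverse b : H →ₗ.[ℂ] H).graph ↔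
      ∃ w, (b : H →L[ℂ] H) w = x ∧ w - (kp b : H →L[ℂ] H) w = y :=
  represents_col_iff.1 (represents_leftInverse b) x y

theorem represents_idOn (c : M.toStarSubalgebra) :
    Represents (col (1 - c) (1 - c))
      (quotient ((1 - c : M.toStarSubalgebra) : H →L[ℂ] H)
        ((1 - c : M.toStarSubalgebra) : H →L[ℂ] H)) :=
  represents_quotient le_rfl

theorem mem_graph_idOn_aux {b : M.toStarSubalgebra} {x y : H} :
    (x, y) ∈ (quotient ((1 - kp b : M.toStarSubalgebra) : H →L[ℂ] H)
        ((1 - kp b : M.toStarSubalgebra) : H →L[ℂ] H)).graph ↔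
      (kp b : H →L[ℂ] H) x = 0 ∧ x = y := by
  rw [represents_col_iff.1 (represents_idOn (kp b))]
  simp only [coe_one_sub_apply]
  constructor
  · rintro ⟨w, rfl, rfl⟩
    refine ⟨?_, rfl⟩
    rw [map_sub, kp_kp, sub_self]
  · rintro ⟨h, rfl⟩
    exact ⟨x, by rw [h, sub_zero], by rw [h, sub_zero]⟩

/-- The restriction of the identity to the orthogonal complement of the kernel of `b`. -/
def idOn (b : M.toStarSubalgebra) : mvnAff M :=
  ⟨quotient ((1 - kp b : M.toStarSubalgebra) : H →L[ℂ] H)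
      ((1 - kp b : M.toStarSubalgebra) : H →L[ℂ] H),
    (represents_idOn (kp b)).mem_mvnAff (by
      have e : ((quotient ((1 - kp b : M.toStarSubalgebra) : H →L[ℂ] H)
          ((1 - kp b : M.toStarSubalgebra) : H →L[ℂ] H)).graph : Set (H × H)) =
          {p | (kp b : H →L[ℂ] H) p.1 = 0} ∩ {p | p.1 = p.2} := by
        ext ⟨x, y⟩
        exact mem_graph_idOn_aux
      change _root_.IsClosed _
      rw [e]
      exact (isClosed_eq (by fun_prop) (by fun_prop)).inter
        (isClosed_eq (by fun_prop) (by fun_prop)))⟩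

theorem mem_graph_idOn {b : M.toStarSubalgebra} {x y : H} :
    (x, y) ∈ (idOn b : H →ₗ.[ℂ] H).graph ↔ (kp b : H →L[ℂ] H) x = 0 ∧ x = y :=
  mem_graph_idOn_aux

theorem domain_idOn (b : M.toStarSubalgebra) (x : H) :
    x ∈ (idOn b : H →ₗ.[ℂ] H).domain ↔ (kp b : H →L[ℂ] H) x = 0 := by
  rw [LinearPMap.mem_domain_iff]
  exact ⟨fun ⟨y, hy⟩ => (mem_graph_idOn.1 hy).1, fun h => ⟨x, mem_graph_idOn.2 ⟨h, rfl⟩⟩⟩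

theorem closure_domain_idOn (b : M.toStarSubalgebra) (x : H) :
    x ∈ (idOn b : H →ₗ.[ℂ] H).domain.topologicalClosure ↔ (kp b : H →L[ℂ] H) x = 0 := by
  constructor
  · intro hx
    have hcl : _root_.IsClosed {z | (kp b : H →L[ℂ] H) z = 0} :=
      isClosed_eq (by fun_prop) (by fun_prop)
    exact closure_minimal (fun z hz => (domain_idOn b z).1 hz) hcl hx
  · intro hx
    exact Submodule.le_topologicalClosure _ ((domain_idOn b x).2 hx)

/-- The adjoint convention takes values in the closure of the domain, so restricting the identity to
a closed subspace gives the projection as adjoint. That projection is in `M`, where `Ψ` is known. -/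
theorem adj_idOn (b : M.toStarSubalgebra) : adj (idOn b) = incl M (1 - kp b) := by
  refine Subtype.ext (LinearPMap.eq_of_eq_graph ?_)
  ext ⟨y, z⟩
  change (y, z) ∈ (opAdjoint (idOn b : H →ₗ.[ℂ] H)).graph ↔ _
  rw [mem_graph_opAdjoint, closure_domain_idOn, mem_graph_incl, coe_one_sub_apply]
  constructor
  · rintro ⟨h1, h2⟩
    refine ext_inner_right ℂ fun w => ?_
    have h3 := h2 _ _ (mem_graph_idOn.2 ⟨by rw [map_sub, kp_kp, sub_self], rfl⟩ :
      (w - (kp b : H →L[ℂ] H) w, w - (kp b : H →L[ℂ] H) w) ∈ (idOn b : H →ₗ.[ℂ] H).graph)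
    simp only [inner_sub_right, ← kp_inner, h1, inner_zero_left, sub_zero] at h3
    rw [inner_sub_left, h3]
  · rintro rfl
    refine ⟨by rw [map_sub, kp_kp, sub_self], fun p q hpq => ?_⟩
    obtain ⟨h1, rfl⟩ := mem_graph_idOn.1 hpq
    rw [inner_sub_left, kp_inner, h1, inner_zero_right, sub_zero]

theorem closure_domain_leftInverse (b : M.toStarSubalgebra) (x : H) :
    x ∈ (leftInverse b : H →ₗ.[ℂ] H).domain.topologicalClosure ↔
      (kp (star b) : H →L[ℂ] H) x = 0 := by
  have h : (leftInverse b : H →ₗ.[ℂ] H).domain = _ := (represents_leftInverse b).domain_eq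
  rw [h, mem_closure_range_iff]

theorem isStrongProd_leftInverse (b : M.toStarSubalgebra) :
    IsStrongProd (leftInverse b) (incl M b) (incl M (1 - kp b)) := by
  refine isStrongProd_of_le (fun x y h => ?_) fun x y h => Submodule.le_topologicalClosure _ ?_
  · obtain ⟨z, h1, h2⟩ := (mem_graph_opMul _ _ _ _).1 h
    rw [mem_graph_incl] at h1
    obtain ⟨w, hw, rfl⟩ := mem_graph_leftInverse.1 h2
    rw [mem_graph_incl, coe_one_sub_apply]
    have h3 : (kp b : H →L[ℂ] H) (x - w) = x - w :=
      kp_apply_of_eq_zero (by rw [map_sub, h1, hw, sub_self])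
    rw [map_sub, sub_eq_sub_iff_add_eq_add] at h3
    rw [sub_eq_sub_iff_add_eq_add, add_comm w, h3, add_comm]
  · rw [mem_graph_incl, coe_one_sub_apply] at h
    exact (mem_graph_opMul _ _ _ _).2
      ⟨_, mem_graph_incl.2 rfl, mem_graph_leftInverse.2 ⟨x, rfl, h⟩⟩

/-- The unclosed product is the identity on the range of `b`. Taking the closure extends it to the
closed range, the complement of `ker b*`. -/
theorem isStrongProd_leftInverse' (b : M.toStarSubalgebra) :
    IsStrongProd (incl M b) (leftInverse b) (idOn (star b)) := by
  have key : ∀ w : H, ((b : H →L[ℂ] H) w, (b : H →L[ℂ] H) w) ∈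
      (opMul (incl M b : H →ₗ.[ℂ] H) (leftInverse b)).graph := fun w =>
    (mem_graph_opMul _ _ _ _).2 ⟨_, mem_graph_leftInverse.2 ⟨w, rfl, rfl⟩,
      mem_graph_incl.2 (by rw [map_sub, apply_kp, sub_zero])⟩
  refine isStrongProd_of_le (fun x y h => ?_) fun x y h => ?_
  · obtain ⟨z, h1, h2⟩ := (mem_graph_opMul _ _ _ _).1 h
    obtain ⟨w, rfl, rfl⟩ := mem_graph_leftInverse.1 h1
    rw [mem_graph_incl, map_sub, apply_kp, sub_zero] at h2
    exact mem_graph_idOn.2 ⟨kp_star_apply b w, h2⟩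
  · obtain ⟨h1, rfl⟩ := mem_graph_idOn.1 h
    rw [← mem_closure_range_iff] at h1
    have hmaps : Set.MapsTo (fun x : H => (x, x))
        (LinearMap.range ((b : H →L[ℂ] H) : H →ₗ[ℂ] H) : Set H)
        ((opMul (incl M b : H →ₗ.[ℂ] H) (leftInverse b)).graph : Set (H × H)) := by
      rintro _ ⟨w, rfl⟩
      exact key w
    have h2 := map_mem_closure (by fun_prop) h1 hmaps
    exact h2

/-- `ker b ⊆ ker a` lets `a` ignore the correction by `kp b`, so the product is already `T`. An
extension is therefore determined by its values on the inverses. -/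
theorem isStrongProd_of_represents {T : mvnAff M} {b a : M.toStarSubalgebra}
    (h : Represents (col b a) (T : H →ₗ.[ℂ] H)) :
    IsStrongProd (incl M a) (leftInverse b) T := by
  have hk := ker_le_of_represents_col h
  have ha : ∀ w, (a : H →L[ℂ] H) ((kp b : H →L[ℂ] H) w) = 0 := fun w => hk (apply_kp b w)
  rw [represents_col_iff] at h
  refine isStrongProd_of_le (fun x y hxy => ?_) fun x y hxy => Submodule.le_topologicalClosure _ ?_
  · obtain ⟨z, h1, h2⟩ := (mem_graph_opMul _ _ _ _).1 hxy
    obtain ⟨w, rfl, rfl⟩ := mem_graph_leftInverse.1 h1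
    rw [mem_graph_incl, map_sub, ha, sub_zero] at h2
    exact (h _ _).2 ⟨w, rfl, h2⟩
  · obtain ⟨w, rfl, rfl⟩ := (h _ _).1 hxy
    exact (mem_graph_opMul _ _ _ _).2 ⟨_, mem_graph_leftInverse.2 ⟨w, rfl, rfl⟩,
      mem_graph_incl.2 (by rw [map_sub, ha, sub_zero])⟩

/-- This encodes the closure of the domain of `U`, and the annihilation of its range by `e`, in one
strong-product, so that both can be carried through `Ψ`. -/
theorem isStrongProd_zeroOn_of_closure_domain {U : mvnAff M} {c e : M.toStarSubalgebra}
    (hdom : ∀ x, x ∈ (U : H →ₗ.[ℂ] H).domain.topologicalClosure ↔ (c : H →L[ℂ] H) x = 0)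
    (hran : ∀ x y, (x, y) ∈ (U : H →ₗ.[ℂ] H).graph → (e : H →L[ℂ] H) y = 0) :
    IsStrongProd (incl M e) U (zeroOn c) := by
  refine isStrongProd_of_le (fun x y h => ?_) fun x y h => ?_
  · obtain ⟨z, h1, h2⟩ := (mem_graph_opMul _ _ _ _).1 h
    rw [mem_graph_incl, hran _ _ h1] at h2
    refine mem_graph_triv_mul.2 ⟨(hdom x).1 (Submodule.le_topologicalClosure _ ?_), h2.symm⟩
    exact LinearPMap.mem_domain_iff.2 ⟨z, h1⟩
  · obtain ⟨h1, rfl⟩ := mem_graph_triv_mul.1 h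
    rw [← hdom] at h1
    have hmaps : Set.MapsTo (fun x : H => (x, (0 : H)))
        ((U : H →ₗ.[ℂ] H).domain : Set H)
        ((opMul (incl M e : H →ₗ.[ℂ] H) U).graph : Set (H × H)) := by
      intro z hz
      obtain ⟨y, hy⟩ := LinearPMap.mem_domain_iff.1 hz
      exact (mem_graph_opMul _ _ _ _).2 ⟨y, hy, mem_graph_incl.2 (hran _ _ hy)⟩
    have h2 := map_mem_closure (by fun_prop) h1 hmaps
    exact h2

end VN

/-! ### Uniqueness of the extension -/

section Morphisms

variable {H : Type u} [NormedAddCommGroup H] [InnerProductSpace ℂ H] [CompleteSpace H]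
  {K : Type v} [NormedAddCommGroup K] [InnerProductSpace ℂ K] [CompleteSpace K]
  {M : VonNeumannAlgebra H} {N : VonNeumannAlgebra K}
  {Φ : M.toStarSubalgebra →⋆ₐ[ℂ] N.toStarSubalgebra} {Ψ : mvnAff M → mvnAff N}

theorem RespectsStrongProd.isStrongProd (hΨ : RespectsStrongProd Ψ) {S T V : mvnAff M}
    (h : IsStrongProd S T V) : IsStrongProd (Ψ S) (Ψ T) (Ψ V) := by
  obtain ⟨h', e⟩ := hΨ S T h.isClosable
  rw [h.strongProd_eq] at e
  rw [IsStrongProd, e]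
  exact h'.graph_closure_eq_closure_graph

theorem IsStrongProd.unique {S T V V' : mvnAff M} (h : IsStrongProd S T V)
    (h' : IsStrongProd S T V') : V = V' :=
  h.strongProd_eq.symm.trans h'.strongProd_eq

namespace IsMvNExtension

variable (hΨ : IsMvNExtension Φ Ψ)
include hΨ

theorem map_zeroOn (c : M.toStarSubalgebra) : Ψ (zeroOn c) = zeroOn (Φ c) := by
  have h := hΨ.strongProd.isStrongProd (isStrongProd_zeroOn c)
  rw [hΨ.trivial, hΨ.ext] at h
  exact h.unique (isStrongProd_zeroOn (Φ c))

theorem apply_eq_zero {U : mvnAff M} {c e : M.toStarSubalgebra}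
    (hdom : ∀ x, x ∈ (U : H →ₗ.[ℂ] H).domain.topologicalClosure ↔ (c : H →L[ℂ] H) x = 0)
    (hran : ∀ x y, (x, y) ∈ (U : H →ₗ.[ℂ] H).graph → (e : H →L[ℂ] H) y = 0) {x y : K}
    (hxy : (x, y) ∈ (Ψ U : K →ₗ.[ℂ] K).graph) :
    (Φ c : K →L[ℂ] K) x = 0 ∧ (Φ e : K →L[ℂ] K) y = 0 := by
  have h := hΨ.strongProd.isStrongProd (isStrongProd_zeroOn_of_closure_domain hdom hran)
  rw [hΨ.map_zeroOn, hΨ.ext] at h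
  exact mem_graph_triv_mul.1 (h.mem_graph hxy (mem_graph_incl.2 rfl))

/-- The adjoint of `Ψ (idOn b)` is the projection `1 - Φ (kp b)`, so `y` pairs with every `w` as `(1
- Φ (kp b)) x` does. The domain condition reduces the latter to `x`. -/
theorem eq_of_mem_graph_idOn {b : M.toStarSubalgebra} {x y : K}
    (hxy : (x, y) ∈ (Ψ (idOn b) : K →ₗ.[ℂ] K).graph) : y = x := by
  -- Only the domain matters here; `e = 0` makes the range condition vacuous.
  have h1 : (Φ (kp b) : K →L[ℂ] K) x = 0 :=
    (hΨ.apply_eq_zero (e := 0) (closure_domain_idOn b) (fun _ _ _ => rfl) hxy).1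
  have h2 := hΨ.adjoint (idOn b)
  rw [adj_idOn, hΨ.ext] at h2
  have h3 : star (Φ (kp b)) = Φ (kp b) := by rw [← map_star, star_kp]
  refine ext_inner_left ℂ fun w => ?_
  have h4 : (w, (Φ (1 - kp b) : K →L[ℂ] K) w) ∈ (adj (Ψ (idOn b)) : K →ₗ.[ℂ] K).graph := by
    rw [← h2]
    exact mem_graph_incl.2 rfl
  have h5 := ((mem_graph_opAdjoint _ _).1 h4).2 x y hxy
  simp only at h5
  rw [← h5, map_sub, map_one, coe_one_sub_apply, inner_sub_left]
  nth_rewrite 1 [← h3]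
  rw [coe_star_inner, h1, inner_zero_right, sub_zero]

theorem map_leftInverse (hΦ : IsNormalHom Φ) (b : M.toStarSubalgebra) :
    Ψ (leftInverse b) = phiMvN Φ hΦ (leftInverse b) := by
  have hp := represents_phiMvN_col hΦ (T := leftInverse b) (represents_leftInverse b)
  suffices h : Represents (col (Φ b) (Φ (1 - kp b))) (Ψ (leftInverse b) : K →ₗ.[ℂ] K) from
    Subtype.ext (h.unique hp)
  have hl := hΨ.strongProd.isStrongProd (isStrongProd_leftInverse b)
  have hr := hΨ.strongProd.isStrongProd (isStrongProd_leftInverse' b)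
  rw [hΨ.ext] at hr
  rw [hΨ.ext, hΨ.ext] at hl
  rw [represents_col_iff]
  intro x y
  constructor
  · intro hxy
    -- The product `b · b⁻¹` goes to a restriction of the identity, so `Φ b y = x`. As `Φ (kp b)`
    -- annihilates `y`, the vector `y` itself serves as the required preimage.
    have h1 := hΨ.eq_of_mem_graph_idOn (hr.mem_graph hxy (mem_graph_incl.2 rfl))
    have h2 := (hΨ.apply_eq_zero (e := kp b) (closure_domain_leftInverse b) (fun p q hpq => by
      obtain ⟨w, -, rfl⟩ := mem_graph_leftInverse.1 hpq
      rw [map_sub, kp_kp, sub_self]) hxy).2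
    refine ⟨y, h1, ?_⟩
    rw [map_sub, map_one, coe_one_sub_apply, h2, sub_zero]
  · rintro ⟨w, rfl, rfl⟩
    have h1 : (w, (Φ (1 - kp b) : K →L[ℂ] K) w) ∈
        (opMul (Ψ (leftInverse b) : K →ₗ.[ℂ] K) (incl N (Φ b))).graph.topologicalClosure := by
      rw [hl]
      exact mem_graph_incl.2 rfl
    -- The product `b⁻¹ · b` is known only up to closure. The continuous map `(p, q) ↦ (Φ b p, q)`
    -- sends the unclosed product into the graph of `Ψ (b⁻¹)`, which is closed and so also receives
    -- the limits.
    have hmaps : Set.MapsTo (fun p : K × K => ((Φ b : K →L[ℂ] K) p.1, p.2))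
        ((opMul (Ψ (leftInverse b) : K →ₗ.[ℂ] K) (incl N (Φ b))).graph : Set (K × K))
        ((Ψ (leftInverse b) : K →ₗ.[ℂ] K).graph : Set (K × K)) := by
      rintro ⟨p, q⟩ hpq
      obtain ⟨z, h2, h3⟩ := (mem_graph_opMul _ _ _ _).1 hpq
      rw [mem_graph_incl] at h2
      subst h2
      exact h3
    have h2 := map_mem_closure (by fun_prop) h1 hmaps
    have h3 : _root_.IsClosed ((Ψ (leftInverse b) : K →ₗ.[ℂ] K).graph : Set (K × K)) :=
      (Ψ (leftInverse b)).2.1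
    rw [h3.closure_eq] at h2
    exact h2

theorem eq_phiMvN (hΦ : IsNormalHom Φ) : Ψ = phiMvN Φ hΦ := by
  funext T
  obtain ⟨b, a, hT⟩ := exists_col_represents T.2
  have h := isStrongProd_of_represents hT
  have h1 := hΨ.strongProd.isStrongProd h
  have h2 := (isMvNExtension_phiMvN hΦ).strongProd.isStrongProd h
  rw [hΨ.map_leftInverse hΦ, hΨ.ext] at h1
  rw [(isMvNExtension_phiMvN hΦ).ext] at h2
  exact h1.unique h2

end IsMvNExtension

end Morphisms

end Affiliation

end

open Affiliation in
theorem mainTheorem8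
    {H : Type*} [NormedAddCommGroup H] [InnerProductSpace ℂ H] [CompleteSpace H]
    {K : Type*} [NormedAddCommGroup K] [InnerProductSpace ℂ K] [CompleteSpace K]
    (M : VonNeumannAlgebra H) (N : VonNeumannAlgebra K)
    (Φ : M.toStarSubalgebra →⋆ₐ[ℂ] N.toStarSubalgebra) (hΦ : IsNormalHom Φ) :
    -- `Φ_aff` is well defined: `Φ_aff (A / B) = Φ A / Φ B` for every quotient of elements of `M`
    (∀ (A B : M.toStarSubalgebra)
        (h : LinearMap.ker ((B : H →L[ℂ] H) : H →ₗ[ℂ] H) ≤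
          LinearMap.ker ((A : H →L[ℂ] H) : H →ₗ[ℂ] H)),
      LinearMap.ker ((Φ B : K →L[ℂ] K) : K →ₗ[ℂ] K) ≤
          LinearMap.ker ((Φ A : K →L[ℂ] K) : K →ₗ[ℂ] K) ∧
        phiAff Φ ⟨quotient (A : H →L[ℂ] H) (B : H →L[ℂ] H), A, B, h, rfl⟩ =
          quotient (Φ A : K →L[ℂ] K) (Φ B : K →L[ℂ] K)) ∧
    -- `Φ_aff` restricts to a map between the sets of MvN-affiliated operators, ...
    ∃ (hM : mvnAff M ⊆ aff M)
      (hN : ∀ T : mvnAff M, phiAff Φ ⟨T, hM T.2⟩ ∈ mvnAff N),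
      -- ... which extends `Φ`, respects strong-product and adjoint, preserves the trivial operator,
      IsMvNExtension Φ (fun T : mvnAff M => (⟨phiAff Φ ⟨T, hM T.2⟩, hN T⟩ : mvnAff N)) ∧
      -- is the only such map,
      (∀ Ψ : mvnAff M → mvnAff N, IsMvNExtension Φ Ψ →
        Ψ = fun T : mvnAff M => (⟨phiAff Φ ⟨T, hM T.2⟩, hN T⟩ : mvnAff N)) ∧
      -- and respects strong-sum
      RespectsStrongSum (fun T : mvnAff M => (⟨phiAff Φ ⟨T, hM T.2⟩, hN T⟩ : mvnAff N)) := by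
  refine ⟨fun A B h => ⟨ker_map_le hΦ h, phiAff_quotient hΦ h _⟩, mvnAff_subset_aff M,
    fun T => (phiMvN Φ hΦ T).2, isMvNExtension_phiMvN hΦ, fun Ψ hΨ => hΨ.eq_phiMvN hΦ,
    respectsStrongSum_phiMvN hΦ⟩
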